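/- **Setting.** Let $M\ge 2$ agents be the vertices of a connected undirected graph $\mathcal G$, and let $W\in\mathbb R^{M\times M}$ be a symmetric matrix with $W\mathbf 1=\mathbf 1$, $w_{ii}>0$, $w_{ij}>0$ for edges $\{i,j\}$ and $w_{ij}=0$ for other $i\ne j$. Let $\lambda_1\ge\dots\ge\lambda_M$ be its eigenvalues, $\rho=1-\max\{\lambda_2,|\lambda_M|\}$ and $\eta=\frac{1-\sqrt{1-(1-\rho)^2}}{1+\sqrt{1-(1-\rho)^2}}$. For $Z\in(\mathbb R^{2d})^M$, $\mathrm{AccGossip}(Z;H)$ is $Z^{H+1}$, where $Z^{-1}=Z^0=Z$ and $Z^{t+1}=(1+\eta)WZ^t-\eta Z^{t-1}$; every multiplication by $W$ is one communication round. Let $\mathcal X,\mathcal Y\subset\mathbb R^d$ be nonempty, convex and compact, $\mathcal Z=\mathcal X\times\mathcal Y$, $f_1,\dots,f_M:\mathbb R^{2d}\to\mathbb R$, $f=\frac1M\sum_m f_m$, $F_m=(\nabla_xf_m,-\nabla_yf_m)$, $F=\frac1M\sum_mF_m$, and let $L,\mu,\delta,r>0$. Assume: each $f_m$ is twice differentiable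 on an open set containing $\mathcal Z$ and is differentiable with $\|F_m(z_1)-F_m(z_2)\|\le L\|z_1-z_2\|$ on the open $r$-neighbourhood of $\mathcal Z$; on $\mathcal Z$, $\langle F(z_1)-F(z_2),z_1-z_2\rangle\ge\mu\|z_1-z_2\|^2$ and $\langle F_m(z_1)-F_m(z_2),z_1-z_2\rangle\ge0$; and on $\mathcal Z$ the operator norms of $\nabla^2_{xx}(f_m-f)$, $\nabla^2_{xy}(f_m-f)$, $\nabla^2_{yy}(f_m-f)$ are at most $\delta$. Let $z^*$ be a solution (saddle point) of $\min_{x\in\mathcal X}\max_{y\in\mathcal Y}f(x,y)$, let $\Omega$ bound $\|z\|$ and $\|z-w\|$ for all $z,w\in\mathcal Z$, and let $G\ge\|F_m(z^*)\|$ for all $m$. **Algorithm.** Parameters $\gamma,\tilde e>0$ and $H_0,H_1\in\mathbb N$; start with $z^0_i=z^0\in\mathcal Z$ for all $i$. In iteration $k=0,1,2,\dots$: compute $(\bar F^k_i)_i=\mathrm{AccGossip}((F_i(z^k_i))_i;H_0)$; draw a node $m=m_k$ uniformly at random; it forms $v^k=z^k_m-\gamma(\bar F^k_m-F_m(z^k_m))$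 and finds $\tilde u^k\in\mathcal Z$ with $\|\tilde u^k-\hat u^k\|^2\le\tilde e\,\|z^k_m-\hat u^k\|^2$, where $\hat u^k$ is the saddle point over $\mathcal X\times\mathcal Y$ of $\gamma f_m(u_x,u_y)+\frac12\|u_x-v^k_x\|^2-\frac12\|u_y-v^k_y\|^2$; then $(u^k_i)_i=M\cdot\mathrm{AccGossip}(0,\dots,\tilde u^k,\dots,0;H_1)$ and $(\bar F^{k+1/2}_i)_i=\mathrm{AccGossip}((F_i(u^k_i))_i;H_0)$; node $m$ sets $\tilde z^{k+1}=\tilde u^k+\gamma(\bar F^k_m-F_m(z^k_m)-\bar F^{k+1/2}_m+F_m(\tilde u^k))$; $(\hat z^{k+1}_i)_i=M\cdot\mathrm{AccGossip}(0,\dots,\tilde z^{k+1},\dots,0;H_1)$ and $z^{k+1}_i=\mathrm{proj}_{\mathcal Z}[\hat z^{k+1}_i]$. (In the tuples with zeros the nonzero entry is in position $m$.) Put $\bar z^k=\frac1M\sum_iz^k_i$. One iteration uses $2(H_0+1)+2(H_1+1)$ communication rounds. **Theorem.** There are absolute constants $C,C'>0$ such that the following holds in this setting for every $\varepsilon>0$.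 Write $\ell(a)=\log(\mathrm e+a)$ with $\mathrm e=\exp(1)$, and put $$\gamma=\min\Big\{\tfrac1{12\mu},\tfrac1{7\delta}\Big\},\qquad \tilde e=\frac1{2\left(2+12\gamma^2\delta^2+\frac4{\gamma\mu}+\frac{8\gamma\delta^2}\mu\right)},$$ $$A_0=\frac{(\gamma^2+\frac\gamma\mu)M(L\Omega+G)^2}{\gamma\mu\rho},\qquad A_1=\frac{(1+\gamma^2L^2+\frac{\gamma L^2}\mu)M\Omega^2}{\gamma\mu\rho},$$ $$H_0=\Big\lceil \tfrac C{\sqrt\rho}\,\ell\big(\tfrac{A_0}\varepsilon\big)\Big\rceil,\quad H_1=\Big\lceil \tfrac C{\sqrt\rho}\,\ell\big(\tfrac{A_1}\varepsilon+\tfrac\Omega{r\rho}\big)\Big\rceil,\quad K=\Big\lceil \tfrac C{\gamma\mu}\,\ell\big(\tfrac{\|z^0-z^*\|^2}\varepsilon\big)\Big\rceil.$$ 1. For every $m$, every $z\in\mathcal Z$ and every $v$, the local subproblem of node $m$ at $v$ has a solution, and at least $C(1+\gamma L)\log(1/\tilde e)$ iterations of the Extragradient method with step $\frac1{4(1+\gamma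 L)}$ started at $z$ produce a point of $\mathcal Z$ of the required accuracy $\tilde e$ relative to $z$. 2. For every realization of the active nodes $m_0,m_1,\dots$ and every choice of admissible approximate solutions $\tilde u^k$, the algorithm satisfies $\|\bar z^k-z^*\|^2\le\varepsilon$ for all $k\ge K$. 3. The number of communication rounds in $K$ iterations is at most $$C'\;\ell\big(\|z^0-z^*\|^2\big)\Big(\ell(A_0)+\ell\big(A_1+\tfrac\Omega{r\rho}\big)\Big)\cdot\frac1{\sqrt\rho}\Big(1+\frac\delta\mu\Big)\,\ell\big(\tfrac1\varepsilon\big)^2,$$ that is, $\tilde{\mathcal O}\big(\frac1{\sqrt\rho}(1+\frac\delta\mu)\log^2\frac1\varepsilon\big)$, where $\tilde{\mathcal O}$ hides the logarithmic factors in the problem parameters displayed before the dot. -/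

import Mathlib

open scoped BigOperators

noncomputable section

namespace MinMaxSimilarity

/-- `ℝ^d` with its Euclidean norm. -/
abbrev E (d : ℕ) : Type := EuclideanSpace ℝ (Fin d)

/-- The space `ℝ^{2d} = ℝ^d × ℝ^d` of pairs `z = (x, y)` with its Euclidean norm. -/
abbrev V (d : ℕ) : Type := WithLp 2 (E d × E d)

variable {d M : ℕ}

/-- The pair `(x, y)` as a point of `ℝ^{2d}`. -/
def pair (x y : E d) : V d := WithLp.toLp 2 (x, y)

/-! ### The saddle point problem -/

/-- The feasible set `𝒵 = 𝒳 × 𝒴`. -/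
def feasible (X Y : Set (E d)) : Set (V d) := {z | z.fst ∈ X ∧ z.snd ∈ Y}

/-- The global objective `f = (1/M) ∑ₘ fₘ`. -/
def avgFun (f : Fin M → V d → ℝ) : V d → ℝ := fun z => (1 / (M : ℝ)) * ∑ m, f m z

/-- The operator `(∇ₓ φ, -∇ᵧ φ)` attached to a function `φ(x, y)`. -/
def spOp (φ : V d → ℝ) (z : V d) : V d := pair (gradient φ z).fst (-(gradient φ z).snd)

/-- The averaged operator `F = (1/M) ∑ₘ Fₘ`, where `Fₘ = spOp (f m)`. -/
def avgOp (f : Fin M → V d → ℝ) (z : V d) : V d := (1 / (M : ℝ)) • ∑ m, spOp (f m) z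

/-- The inclusion `x ↦ (x, 0)`. -/
def inlL : E d →L[ℝ] V d :=
  ((WithLp.prodContinuousLinearEquiv 2 ℝ (E d) (E d)).symm : (E d × E d) →L[ℝ] V d).comp
    (ContinuousLinearMap.inl ℝ (E d) (E d))

/-- The inclusion `y ↦ (0, y)`. -/
def inrL : E d →L[ℝ] V d :=
  ((WithLp.prodContinuousLinearEquiv 2 ℝ (E d) (E d)).symm : (E d × E d) →L[ℝ] V d).comp
    (ContinuousLinearMap.inr ℝ (E d) (E d))

/-- The Hessian `∇²φ(z)`, the derivative of the gradient. -/
def hess (φ : V d → ℝ) (z : V d) : V d →L[ℝ] V d := fderiv ℝ (gradient φ) z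

/-- The block `∇²ₓₓ φ(z)`. -/
def hessXX (φ : V d → ℝ) (z : V d) : E d →L[ℝ] E d :=
  (WithLp.fstL 2 ℝ (E d) (E d)).comp ((hess φ z).comp inlL)

/-- The block `∇²ₓᵧ φ(z)`. -/
def hessXY (φ : V d → ℝ) (z : V d) : E d →L[ℝ] E d :=
  (WithLp.fstL 2 ℝ (E d) (E d)).comp ((hess φ z).comp inrL)

/-- The block `∇²ᵧᵧ φ(z)`. -/
def hessYY (φ : V d → ℝ) (z : V d) : E d →L[ℝ] E d :=
  (WithLp.sndL 2 ℝ (E d) (E d)).comp ((hess φ z).comp inrL)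

/-- `z ∈ 𝒳 × 𝒴` solves `min_{x ∈ 𝒳} max_{y ∈ 𝒴} φ(x, y)`: it is a saddle point of `φ`. -/
def IsSolution (X Y : Set (E d)) (φ : V d → ℝ) (z : V d) : Prop :=
  z ∈ feasible X Y ∧ IsSaddlePointOn X Y (fun x y => φ (pair x y)) z.fst z.snd

/-- The standing assumptions on the problem: `𝒳`, `𝒴` are nonempty compact convex sets; each `fₘ`
is twice differentiable on an open set containing `𝒵` and has an `L`-Lipschitz gradient on the
open `r`-neighbourhood of `𝒵`; `f` is `μ`-strongly convex-strongly concave and each `fₘ` is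
convex-concave on `𝒵` (monotonicity of the corresponding operators). -/
structure IsSmoothSaddleProblem (X Y : Set (E d)) (f : Fin M → V d → ℝ) (L μ r : ℝ) : Prop where
  compactX : IsCompact X
  compactY : IsCompact Y
  convexX : Convex ℝ X
  convexY : Convex ℝ Y
  nonempty : (feasible X Y).Nonempty
  twiceDiff : ∀ m, ∃ U : Set (V d), IsOpen U ∧ feasible X Y ⊆ U ∧
    DifferentiableOn ℝ (f m) U ∧ DifferentiableOn ℝ (gradient (f m)) U
  diff : ∀ m, DifferentiableOn ℝ (f m) (Metric.thickening r (feasible X Y))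
  lipschitz : ∀ m, ∀ z₁ ∈ Metric.thickening r (feasible X Y),
    ∀ z₂ ∈ Metric.thickening r (feasible X Y), ‖spOp (f m) z₁ - spOp (f m) z₂‖ ≤ L * ‖z₁ - z₂‖
  stronglyMonotone : ∀ z₁ ∈ feasible X Y, ∀ z₂ ∈ feasible X Y,
    μ * ‖z₁ - z₂‖ ^ 2 ≤ inner ℝ (avgOp f z₁ - avgOp f z₂) (z₁ - z₂)
  monotone : ∀ m, ∀ z₁ ∈ feasible X Y, ∀ z₂ ∈ feasible X Y,
    0 ≤ inner ℝ (spOp (f m) z₁ - spOp (f m) z₂) (z₁ - z₂)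

/-- The local functions are `δ`-related on `𝒵` (operator norms of the blocks). -/
def IsRelated (X Y : Set (E d)) (f : Fin M → V d → ℝ) (δ : ℝ) : Prop :=
  ∀ m, ∀ z ∈ feasible X Y,
    ‖hessXX (f m) z - hessXX (avgFun f) z‖ ≤ δ ∧
    ‖hessXY (f m) z - hessXY (avgFun f) z‖ ≤ δ ∧
    ‖hessYY (f m) z - hessYY (avgFun f) z‖ ≤ δ

/-! ### Gossip -/

/-- `W` is a gossip matrix compliant with the graph `G`. -/
structure IsGossipMatrix (G : SimpleGraph (Fin M)) (W : Matrix (Fin M) (Fin M) ℝ) : Prop where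
  diag_pos : ∀ i, 0 < W i i
  edge_pos : ∀ i j, G.Adj i j → 0 < W i j
  nonedge : ∀ i j, i ≠ j → ¬ G.Adj i j → W i j = 0
  symm : W.IsSymm
  stochastic : ∀ i, ∑ j, W i j = 1

theorem IsGossipMatrix.isHermitian {G : SimpleGraph (Fin M)} {W : Matrix (Fin M) (Fin M) ℝ}
    (h : IsGossipMatrix G W) : W.IsHermitian := by
  have hs := h.symm
  unfold Matrix.IsSymm at hs
  unfold Matrix.IsHermitian
  rw [Matrix.conjTranspose_eq_transpose_of_trivial, hs]

/-- `ρ = 1 - max {λ₂(W), |λ_min(W)|}`, where `λ₁ ≥ λ₂ ≥ … ≥ λ_M = λ_min` are the eigenvalues of the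
symmetric matrix `W` (`eigenvalues₀` lists them in nonincreasing order, starting from index `0`). -/
def eigengap {W : Matrix (Fin M) (Fin M) ℝ} (hW : W.IsHermitian) (hM : 2 ≤ M) : ℝ :=
  1 - max (hW.eigenvalues₀ ⟨1, by simp only [Fintype.card_fin]; omega⟩)
    |hW.eigenvalues₀ ⟨M - 1, by simp only [Fintype.card_fin]; omega⟩|

/-- The momentum `η = (1 - √(1 - σ²)) / (1 + √(1 - σ²))`, where `σ = 1 - ρ` is the second largest
absolute value of an eigenvalue of `W`. -/
def momentum (ρ : ℝ) : ℝ :=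
  (1 - Real.sqrt (1 - (1 - ρ) ^ 2)) / (1 + Real.sqrt (1 - (1 - ρ) ^ 2))

/-- The sequence `t ↦ (Z^t, Z^{t-1})` of accelerated gossip: `Z^{-1} = Z^0 = Z` and
`Z^{t+1} = (1 + η) W Z^t - η Z^{t-1}`.  One step costs one communication round
(one multiplication by `W`). -/
def gossipSeq (W : Matrix (Fin M) (Fin M) ℝ) (η : ℝ) (Z : Fin M → V d) :
    ℕ → (Fin M → V d) × (Fin M → V d)
  | 0 => (Z, Z)
  | t + 1 =>
    (fun i => (1 + η) • (∑ j, W i j • (gossipSeq W η Z t).1 j) - η • (gossipSeq W η Z t).2 i,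
      (gossipSeq W η Z t).1)

/-- `AccGossip(Z; H)`: the loop runs over `t = 0, …, H` and returns the rows of `Z^{H+1}`. -/
def accGossip (W : Matrix (Fin M) (Fin M) ℝ) (η : ℝ) (H : ℕ) (Z : Fin M → V d) : Fin M → V d :=
  (gossipSeq W η Z (H + 1)).1

/-! ### The algorithm -/

/-- The Euclidean projection onto `S` (a closed convex set in all its uses below). -/
def proj (S : Set (V d)) (z : V d) : V d :=
  Classical.epsilon fun p => p ∈ S ∧ ∀ w ∈ S, ‖z - p‖ ≤ ‖z - w‖

/-- The objective `γ φ(u) + ½ ‖uₓ - vₓ‖² - ½ ‖uᵧ - vᵧ‖²` of the local subproblem. -/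
def subObj (γ : ℝ) (φ : V d → ℝ) (v u : V d) : ℝ :=
  γ * φ u + 1 / 2 * ‖u.fst - v.fst‖ ^ 2 - 1 / 2 * ‖u.snd - v.snd‖ ^ 2

/-- `u ∈ 𝒵` is an approximate solution of the local subproblem at `v`: its squared distance to the
exact solution is at most `e` times the squared distance of the starting point `z` to it. -/
def IsApproxSolution (X Y : Set (E d)) (γ e : ℝ) (φ : V d → ℝ) (z v u : V d) : Prop :=
  u ∈ feasible X Y ∧
    ∃ uhat, IsSolution X Y (subObj γ φ v) uhat ∧ ‖u - uhat‖ ^ 2 ≤ e * ‖z - uhat‖ ^ 2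

/-- The operator of the local subproblem at `v`. -/
def subOp (γ : ℝ) (φ : V d → ℝ) (v u : V d) : V d := γ • spOp φ u + u - v

/-- `T` iterations of the Extragradient method with step `τ`, started at `z`, for the local
subproblem at `v`. -/
def extragradient (X Y : Set (E d)) (γ τ : ℝ) (φ : V d → ℝ) (z v : V d) : ℕ → V d
  | 0 => z
  | T + 1 =>
    let u := extragradient X Y γ τ φ z v T
    let w := proj (feasible X Y) (u - τ • subOp γ φ v u)
    proj (feasible X Y) (u - τ • subOp γ φ v w)

/-- The vectors `F̄_1, …, F̄_M` obtained by gossiping the local operators at the local points. -/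
def gossipOp (f : Fin M → V d → ℝ) (W : Matrix (Fin M) (Fin M) ℝ) (η : ℝ) (H₀ : ℕ)
    (z : Fin M → V d) : Fin M → V d :=
  accGossip W η H₀ (fun i => spOp (f i) (z i))

/-- Propagation of a vector `a` of node `m`: `M · AccGossip(0, …, 0, a, 0, …, 0; H₁)`. -/
def spread (W : Matrix (Fin M) (Fin M) ℝ) (η : ℝ) (H₁ : ℕ) (m : Fin M) (a : V d) :
    Fin M → V d :=
  fun i => (M : ℝ) • accGossip W η H₁ (Pi.single m a) i

/-- The point `v^k_m = z^k_m - γ (F̄^k_m - F_m(z^k_m))` of the active node `m`. -/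
def vPoint (f : Fin M → V d → ℝ) (W : Matrix (Fin M) (Fin M) ℝ) (η γ : ℝ) (H₀ : ℕ)
    (m : Fin M) (z : Fin M → V d) : V d :=
  z m - γ • (gossipOp f W η H₀ z m - spOp (f m) (z m))

/-- The point `z̃^{k+1}_m` of the active node `m`, from the current points `z` of the nodes and the
approximate solution `u` of the subproblem of node `m`. -/
def zTilde (f : Fin M → V d → ℝ) (W : Matrix (Fin M) (Fin M) ℝ) (η γ : ℝ) (H₀ H₁ : ℕ)
    (m : Fin M) (z : Fin M → V d) (u : V d) : V d :=
  u + γ • (gossipOp f W η H₀ z m - spOp (f m) (z m)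
    - gossipOp f W η H₀ (spread W η H₁ m u) m + spOp (f m) u)

/-- `z` is the sequence of the local points `z^k_i` of a run of the distributed algorithm from
`z⁰`, with step `γ`, relative accuracy `e` of the subproblems and gossip parameters `H₀`, `H₁`; the
active node of iteration `k` is `node k` and its approximate solution is `u k`. -/
structure IsRun (X Y : Set (E d)) (f : Fin M → V d → ℝ) (W : Matrix (Fin M) (Fin M) ℝ)
    (η γ e : ℝ) (H₀ H₁ : ℕ) (z₀ : V d) (node : ℕ → Fin M) (u : ℕ → V d)
    (z : ℕ → Fin M → V d) : Prop where
  init : ∀ i, z 0 i = z₀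
  solve : ∀ k, IsApproxSolution X Y γ e (f (node k)) (z k (node k))
    (vPoint f W η γ H₀ (node k) (z k)) (u k)
  update : ∀ k i, z (k + 1) i =
    proj (feasible X Y)
      (spread W η H₁ (node k) (zTilde f W η γ H₀ H₁ (node k) (z k) (u k)) i)

/-- The average `z̄ = (1/M) ∑ᵢ zᵢ` of the local points. -/
def avgPoint (z : Fin M → V d) : V d := (1 / (M : ℝ)) • ∑ i, z i

/-- The number of communication rounds in `k` iterations: every iteration calls accelerated gossip
four times, twice with parameter `H₀` and twice with parameter `H₁`, and a call with parameter `H`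
uses `H + 1` rounds. -/
def commRounds (H₀ H₁ k : ℕ) : ℕ := k * ((H₀ + 1) + (H₁ + 1) + (H₀ + 1) + (H₁ + 1))

/-! ### Tuning -/

/-- The step size `γ = min {1/(12μ), 1/(7δ)}`. -/
def stepSize (μ δ : ℝ) : ℝ := min (1 / (12 * μ)) (1 / (7 * δ))

/-- The relative accuracy `ẽ` of the subproblems. -/
def innerAcc (γ μ δ : ℝ) : ℝ :=
  1 / (2 * (2 + 12 * γ ^ 2 * δ ^ 2 + 4 / (γ * μ) + 8 * γ * δ ^ 2 / μ))

/-- `log (e + a)`, a logarithm that is at least `1` for `a ≥ 0`. -/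
def logE (a : ℝ) : ℝ := Real.log (Real.exp 1 + a)

/-- `(γ² + γ/μ) M (L Ω + G)² / (γ μ ρ)`; divided by `ε` it is the argument of the logarithm
in `H₀`. -/
def argH₀ (M : ℕ) (γ μ L Ω G ρ : ℝ) : ℝ :=
  (γ ^ 2 + γ / μ) * M * (L * Ω + G) ^ 2 / (γ * μ * ρ)

/-- `(1 + γ² L² + γ L²/μ) M Ω² / (γ μ ρ)`; divided by `ε` it is the main part of the argument of the
logarithm in `H₁`. -/
def argH₁ (M : ℕ) (γ μ L Ω ρ : ℝ) : ℝ :=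
  (1 + γ ^ 2 * L ^ 2 + γ * L ^ 2 / μ) * M * Ω ^ 2 / (γ * μ * ρ)

end MinMaxSimilarity

end

/-! The method is an inexact forward-backward-forward scheme for the splitting `F = F_m + (F -
F_m)`. The local part `F_m` is treated implicitly, through the subproblem of the active node; only
the deviation `F - F_m` is evaluated explicitly, with a correction at the second point. Bounded
blocks of the Hessian deviation make it `2δ`-Lipschitz (`norm_deviation_sub_le`), so the step is
limited by `δ` and not by `L`. With exact communication one iteration contracts the squared distance
to the solution by `1 - γμ/2` (`norm_sq_sliding_step_le`), whichever node is active; this is why the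
bound holds for every realization and no expectation appears.

The rest is perturbation theory. Accelerated gossip is a heavy ball recurrence tuned to critical
damping: after `t` rounds the distance to consensus has shrunk by `(2t + 1) √η ^ t`, where `√η ≤ exp
(-√ρ / 2)` (`norm_le_of_momentum_recurrence`, `sqrt_momentum_le`). Its errors enter in two ways:
averaged operators are known up to `lam`, and vectors sent to the other nodes arrive up to `S`.
`iteration_le` propagates an invariant under which the nodes stay in the feasible set, at mutual
distance at most `2 S`, with one common bound on their squared distances to the solution; that bound
contracts by `1 - γμ/4` up to an additive error. Summing the geometric series leaves `4 / (γμ)`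
times this error.

Finally, `gossip_error_le` shows that the chosen `H₀` and `H₁` push the accumulated error below `ε /
2`, while `K` iterations push the initial term below `ε / 2` (`one_sub_pow_mul_le`). The diameter
bound settles the case `ε ≥ D ^ 2`, so the error estimates may assume `ε < D ^ 2`. -/

namespace MinMaxSimilarity

/-! ### Spectrum of a gossip matrix and the heavy ball recurrence -/

section Gossip

variable {d M : ℕ} {G : SimpleGraph (Fin M)} {W : Matrix (Fin M) (Fin M) ℝ}

theorem IsGossipMatrix.nonneg (hW : IsGossipMatrix G W) (i j : Fin M) : 0 ≤ W i j := by
  by_cases hij : i = j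
  · subst hij; exact (hW.diag_pos i).le
  · by_cases h : G.Adj i j
    · exact (hW.edge_pos i j h).le
    · exact (hW.nonedge i j hij h).ge

theorem IsGossipMatrix.apply_comm (hW : IsGossipMatrix G W) (i j : Fin M) : W i j = W j i :=
  (hW.symm.apply j i).symm ▸ rfl

theorem IsGossipMatrix.colSum (hW : IsGossipMatrix G W) (j : Fin M) : ∑ i, W i j = 1 := by
  rw [← hW.stochastic j]
  exact Finset.sum_congr rfl fun i _ => hW.apply_comm i j

/-- The Dirichlet form of `W`. With `c = 1` its nonnegativity bounds the spectrum above by `1` and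
its kernel is read off along edges; with `c = -1` it bounds the spectrum below by `-1`. -/
theorem IsGossipMatrix.sum_mul_sub_sq (hW : IsGossipMatrix G W) (c : ℝ) (v : Fin M → ℝ) :
    ∑ i, ∑ j, W i j * (v i - c * v j) ^ 2 =
      (1 + c ^ 2) * ∑ i, v i ^ 2 - 2 * c * ∑ i, v i * (W.mulVec v) i := by
  have h1 : ∑ i, ∑ j, W i j * v i ^ 2 = ∑ i, v i ^ 2 := by
    refine Finset.sum_congr rfl fun i _ => ?_
    rw [← Finset.sum_mul, hW.stochastic, one_mul]
  have h2 : ∑ i, ∑ j, W i j * v j ^ 2 = ∑ i, v i ^ 2 := by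
    rw [Finset.sum_comm]
    refine Finset.sum_congr rfl fun i _ => ?_
    rw [← Finset.sum_mul, hW.colSum, one_mul]
  have h3 : ∑ i, v i * (W.mulVec v) i = ∑ i, ∑ j, W i j * (v i * v j) := by
    refine Finset.sum_congr rfl fun i _ => ?_
    simp only [Matrix.mulVec, dotProduct, Finset.mul_sum]
    exact Finset.sum_congr rfl fun j _ => by ring
  have h4 : ∀ i j, W i j * (v i - c * v j) ^ 2 =
      W i j * v i ^ 2 + c ^ 2 * (W i j * v j ^ 2) - 2 * c * (W i j * (v i * v j)) :=
    fun i j => by ring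
  simp only [h4, Finset.sum_sub_distrib, Finset.sum_add_distrib, ← Finset.mul_sum, h1, h2, h3]
  ring

theorem IsGossipMatrix.eigenvalue_le_one (hW : IsGossipMatrix G W) {l : ℝ} {v : Fin M → ℝ}
    (hv : 0 < ∑ i, v i ^ 2) (h : W.mulVec v = l • v) : l ≤ 1 := by
  have h1 := hW.sum_mul_sub_sq 1 v
  have h2 : 0 ≤ ∑ i, ∑ j, W i j * (v i - 1 * v j) ^ 2 :=
    Finset.sum_nonneg fun i _ => Finset.sum_nonneg fun j _ =>
      mul_nonneg (hW.nonneg i j) (sq_nonneg _)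
  have h3 : ∑ i, v i * (W.mulVec v) i = l * ∑ i, v i ^ 2 := by
    rw [h, Finset.mul_sum]
    exact Finset.sum_congr rfl fun i _ => by simp only [Pi.smul_apply, smul_eq_mul]; ring
  rw [h1, h3] at h2
  by_contra! hl
  nlinarith

theorem IsGossipMatrix.neg_one_lt_eigenvalue (hW : IsGossipMatrix G W) {l : ℝ} {v : Fin M → ℝ}
    (hv : 0 < ∑ i, v i ^ 2) (h : W.mulVec v = l • v) : -1 < l := by
  have h1 := hW.sum_mul_sub_sq (-1) v
  obtain ⟨i₀, hi₀⟩ : ∃ i, v i ≠ 0 := by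
    by_contra! h0
    simp [h0] at hv
  have h2 : 0 < ∑ i, ∑ j, W i j * (v i - (-1) * v j) ^ 2 := by
    -- The diagonal term at `i₀` is `W i₀ i₀ * (2 * v i₀) ^ 2 > 0`: positive self-weights are what
    -- exclude the eigenvalue `-1`.
    refine Finset.sum_pos' (fun i _ => Finset.sum_nonneg fun j _ =>
      mul_nonneg (hW.nonneg i j) (sq_nonneg _)) ⟨i₀, Finset.mem_univ _, ?_⟩
    refine Finset.sum_pos' (fun j _ => mul_nonneg (hW.nonneg i₀ j) (sq_nonneg _))
      ⟨i₀, Finset.mem_univ _, mul_pos (hW.diag_pos i₀) ?_⟩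
    have : v i₀ - (-1) * v i₀ = 2 * v i₀ := by ring
    rw [this]; positivity
  have h3 : ∑ i, v i * (W.mulVec v) i = l * ∑ i, v i ^ 2 := by
    rw [h, Finset.mul_sum]
    exact Finset.sum_congr rfl fun i _ => by simp only [Pi.smul_apply, smul_eq_mul]; ring
  rw [h1, h3] at h2
  nlinarith

/-- The Dirichlet form vanishes at a fixed vector, so the vector agrees at the ends of every edge;
connectedness then makes it constant. -/
theorem IsGossipMatrix.eq_of_mulVec_eq (hW : IsGossipMatrix G W) (hG : G.Connected)
    {v : Fin M → ℝ} (h : W.mulVec v = v) (i j : Fin M) : v i = v j := by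
  have h1 := hW.sum_mul_sub_sq 1 v
  have h3 : ∑ i, v i * (W.mulVec v) i = ∑ i, v i ^ 2 := by
    rw [h]
    exact Finset.sum_congr rfl fun i _ => by ring
  have h2 : ∑ i, ∑ j, W i j * (v i - 1 * v j) ^ 2 = 0 := by rw [h1, h3]; ring
  have hadj : ∀ a b, G.Adj a b → v a = v b := by
    intro a b hab
    have h4 := (Finset.sum_eq_zero_iff_of_nonneg fun i _ => Finset.sum_nonneg fun j _ =>
      mul_nonneg (hW.nonneg i j) (sq_nonneg (v i - 1 * v j))).1 h2 a (Finset.mem_univ a)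
    have h5 := (Finset.sum_eq_zero_iff_of_nonneg fun j _ =>
      mul_nonneg (hW.nonneg a j) (sq_nonneg (v a - 1 * v j))).1 h4 b (Finset.mem_univ b)
    rcases mul_eq_zero.1 h5 with h6 | h6
    · exact absurd h6 (hW.edge_pos a b hab).ne'
    · have := pow_eq_zero_iff (two_ne_zero) |>.1 h6
      linarith
  obtain ⟨p⟩ := hG.preconnected i j
  induction p with
  | nil => rfl
  | cons hab _ ih => exact (hadj _ _ hab).trans ih

theorem sum_sq_eigenvectorBasis (hH : W.IsHermitian) (j : Fin M) :
    ∑ i, (hH.eigenvectorBasis j).ofLp i ^ 2 = 1 := by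
  have h := hH.eigenvectorBasis.orthonormal.1 j
  have h2 := EuclideanSpace.real_norm_sq_eq (hH.eigenvectorBasis j)
  rw [h] at h2
  linarith

theorem inner_eq_sum_mul (u v : EuclideanSpace ℝ (Fin M)) :
    inner ℝ u v = ∑ i, u.ofLp i * v.ofLp i := by
  rw [PiLp.inner_apply]
  exact Finset.sum_congr rfl fun i _ => by simp [mul_comm]

theorem IsGossipMatrix.inner_mulVec (hW : IsGossipMatrix G W) (j : Fin M) (v : Fin M → ℝ) :
    inner ℝ (hW.isHermitian.eigenvectorBasis j) (WithLp.toLp 2 (W.mulVec v)) =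
      hW.isHermitian.eigenvalues j *
        inner ℝ (hW.isHermitian.eigenvectorBasis j) (WithLp.toLp 2 v) := by
  have h := hW.isHermitian.mulVec_eigenvectorBasis j
  rw [inner_eq_sum_mul, inner_eq_sum_mul]
  set u := (hW.isHermitian.eigenvectorBasis j).ofLp with hu
  have h1 : ∑ i, u i * (W.mulVec v) i = ∑ i, (W.mulVec u) i * v i := by
    simp only [Matrix.mulVec, dotProduct, Finset.mul_sum, Finset.sum_mul]
    rw [Finset.sum_comm]
    refine Finset.sum_congr rfl fun i _ => Finset.sum_congr rfl fun k _ => ?_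
    rw [hW.apply_comm k i]; ring
  change ∑ i, u i * (W.mulVec v) i = _
  rw [h1, h, Finset.mul_sum]
  exact Finset.sum_congr rfl fun i _ => by simp only [Pi.smul_apply, smul_eq_mul]; ring

/-- Links the sorted list, in which `ρ` is defined, to the indexing that carries the eigenvectors.
-/
theorem eigenvalues₀_eq_eigenvalues (hH : W.IsHermitian) (k : Fin (Fintype.card (Fin M))) :
    hH.eigenvalues₀ k = hH.eigenvalues (Fintype.equivOfCardEq (Fintype.card_fin _) k) := by
  simp [Matrix.IsHermitian.eigenvalues]

theorem IsGossipMatrix.eigenvalues_le_one (hW : IsGossipMatrix G W) (j : Fin M) :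
    hW.isHermitian.eigenvalues j ≤ 1 :=
  hW.eigenvalue_le_one (by rw [sum_sq_eigenvectorBasis hW.isHermitian j]; norm_num)
    (hW.isHermitian.mulVec_eigenvectorBasis j)

theorem IsGossipMatrix.neg_one_lt_eigenvalues (hW : IsGossipMatrix G W) (j : Fin M) :
    -1 < hW.isHermitian.eigenvalues j :=
  hW.neg_one_lt_eigenvalue (by rw [sum_sq_eigenvectorBasis hW.isHermitian j]; norm_num)
    (hW.isHermitian.mulVec_eigenvectorBasis j)

/-- Eigenvectors for the eigenvalue `1` are constant, and two nonzero constant vectors are never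
orthogonal, so this eigenvalue is simple. -/
theorem IsGossipMatrix.eigenvalues_lt_one_of_ne (hW : IsGossipMatrix G W) (hG : G.Connected)
    {i j : Fin M} (hij : i ≠ j) (hi : hW.isHermitian.eigenvalues i = 1) :
    hW.isHermitian.eigenvalues j < 1 := by
  refine lt_of_le_of_ne (hW.eigenvalues_le_one j) fun hj => ?_
  have hconst : ∀ k, hW.isHermitian.eigenvalues k = 1 → ∀ a b,
      (hW.isHermitian.eigenvectorBasis k).ofLp a = (hW.isHermitian.eigenvectorBasis k).ofLp b := by
    intro k hk
    refine hW.eq_of_mulVec_eq hG ?_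
    rw [hW.isHermitian.mulVec_eigenvectorBasis, hk, one_smul]
  have h0 := hW.isHermitian.eigenvectorBasis.orthonormal.2 hij
  change inner ℝ _ _ = (0 : ℝ) at h0
  rw [inner_eq_sum_mul] at h0
  have hM : (0 : ℝ) < M := by exact_mod_cast i.pos
  have h1 := sum_sq_eigenvectorBasis hW.isHermitian i
  have h2 := sum_sq_eigenvectorBasis hW.isHermitian j
  set a := (hW.isHermitian.eigenvectorBasis i).ofLp i with ha
  set b := (hW.isHermitian.eigenvectorBasis j).ofLp i with hb
  have e1 : ∀ k, (hW.isHermitian.eigenvectorBasis i).ofLp k = a := fun k => hconst i hi k i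
  have e2 : ∀ k, (hW.isHermitian.eigenvectorBasis j).ofLp k = b := fun k => hconst j hj k i
  simp only [e1, e2, Finset.sum_const, Finset.card_univ, Fintype.card_fin, nsmul_eq_mul] at h0 h1 h2
  have h3 : a * b = 0 := by
    rcases mul_eq_zero.1 h0 with h | h
    · exact absurd h hM.ne'
    · exact h
  rcases mul_eq_zero.1 h3 with h | h <;> simp [h] at h1 h2

/-- The second largest modulus of an eigenvalue of a gossip matrix lies in `[0, 1)`. -/
theorem IsGossipMatrix.eigengap_mem (hW : IsGossipMatrix G W) (hG : G.Connected) (hM : 2 ≤ M) :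
    0 < eigengap hW.isHermitian hM ∧ eigengap hW.isHermitian hM ≤ 1 := by
  have hanti := hW.isHermitian.eigenvalues₀_antitone
  have hlt : hW.isHermitian.eigenvalues₀ ⟨1, by simp only [Fintype.card_fin]; omega⟩ < 1 := by
    by_contra! h1
    have h0 : hW.isHermitian.eigenvalues₀ ⟨1, by simp only [Fintype.card_fin]; omega⟩ ≤
        hW.isHermitian.eigenvalues₀ ⟨0, by simp only [Fintype.card_fin]; omega⟩ :=
      hanti (by simp)
    have h2 := h1.trans h0
    rw [eigenvalues₀_eq_eigenvalues] at h1 h2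
    refine absurd (hW.eigenvalues_lt_one_of_ne hG ?_ (le_antisymm (hW.eigenvalues_le_one _) h2))
      (not_lt.2 h1)
    simp
  have hle : hW.isHermitian.eigenvalues₀ ⟨M - 1, by simp only [Fintype.card_fin]; omega⟩ ≤
      hW.isHermitian.eigenvalues₀ ⟨1, by simp only [Fintype.card_fin]; omega⟩ :=
    hanti (by simp only [Fin.mk_le_mk]; omega)
  have hgt : -1 < hW.isHermitian.eigenvalues₀ ⟨M - 1, by simp only [Fintype.card_fin]; omega⟩ := by
    rw [eigenvalues₀_eq_eigenvalues]; exact hW.neg_one_lt_eigenvalues _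
  unfold eigengap
  constructor
  · have : |hW.isHermitian.eigenvalues₀ ⟨M - 1, by simp only [Fintype.card_fin]; omega⟩| < 1 :=
      abs_lt.2 ⟨hgt, hle.trans_lt hlt⟩
    linarith [max_lt hlt this]
  · have := abs_nonneg (hW.isHermitian.eigenvalues₀ ⟨M - 1, by simp only [Fintype.card_fin]; omega⟩)
    linarith [le_max_right (hW.isHermitian.eigenvalues₀ ⟨1, by simp only [Fintype.card_fin]; omega⟩)
      |hW.isHermitian.eigenvalues₀ ⟨M - 1, by simp only [Fintype.card_fin]; omega⟩|]

/-- On vectors orthogonal to `1` a gossip matrix contracts by the factor `1 - ρ`. -/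
theorem IsGossipMatrix.sum_mulVec_sq_le (hW : IsGossipMatrix G W) (hG : G.Connected) (hM : 2 ≤ M)
    (v : Fin M → ℝ) (hv : ∑ i, v i = 0) :
    ∑ i, (W.mulVec v) i ^ 2 ≤ (1 - eigengap hW.isHermitian hM) ^ 2 * ∑ i, v i ^ 2 := by
  have hH := hW.isHermitian
  set σ := 1 - eigengap hW.isHermitian hM with hσ
  have hσ0 : 0 ≤ σ := by linarith [(hW.eigengap_mem hG hM).2]
  have hσ1 : σ < 1 := by linarith [(hW.eigengap_mem hG hM).1]
  have hanti := hW.isHermitian.eigenvalues₀_antitone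
  let e : Fin (Fintype.card (Fin M)) ≃ Fin M := Fintype.equivOfCardEq (Fintype.card_fin _)
  set j₀ : Fin M := e ⟨0, by simp only [Fintype.card_fin]; omega⟩ with hj₀
  -- In the sorted list every eigenvalue but the first lies between the last and the second.
  have habs : ∀ j, j ≠ j₀ → |hW.isHermitian.eigenvalues j| ≤ σ := by
    intro j hj
    obtain ⟨k, rfl⟩ := e.surjective j
    have hk : k ≠ ⟨0, by simp only [Fintype.card_fin]; omega⟩ := fun h => hj (by rw [hj₀, h])
    have hk1 : (⟨1, by simp only [Fintype.card_fin]; omega⟩ : Fin (Fintype.card (Fin M))) ≤ k := by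
      rw [Fin.le_def]
      have : k.val ≠ 0 := fun h => hk (Fin.ext h)
      change 1 ≤ k.val
      omega
    have hk2 : k ≤ (⟨M - 1, by simp only [Fintype.card_fin]; omega⟩ :
        Fin (Fintype.card (Fin M))) := by
      rw [Fin.le_def]
      have h1 := k.isLt
      have h2 := Fintype.card_fin M
      change k.val ≤ M - 1
      omega
    have h1 := hanti hk1
    have h2 := hanti hk2
    rw [← eigenvalues₀_eq_eigenvalues hW.isHermitian k]
    have hs : σ = max (hW.isHermitian.eigenvalues₀ ⟨1, by simp only [Fintype.card_fin]; omega⟩)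
      |hW.isHermitian.eigenvalues₀ ⟨M - 1, by simp only [Fintype.card_fin]; omega⟩| := by
      rw [hσ]; unfold eigengap; ring
    rw [hs, abs_le]
    constructor
    · refine (neg_le_neg (le_max_right _ _)).trans ((neg_abs_le _).trans h2)
    · exact h1.trans (le_max_left _ _)
  set b := hW.isHermitian.eigenvectorBasis with hb
  let one : EuclideanSpace ℝ (Fin M) := WithLp.toLp 2 (fun _ => 1)
  have hone : W.mulVec (fun _ => (1 : ℝ)) = fun _ => 1 := by
    ext i
    simp only [Matrix.mulVec, dotProduct, mul_one]
    exact hW.stochastic i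
  have hb1 : ∀ j, j ≠ j₀ → inner ℝ (b j) one = 0 := by
    intro j hj
    have h := hW.inner_mulVec j (fun _ => 1)
    rw [hone] at h
    have h' := habs j hj
    have h2 : hW.isHermitian.eigenvalues j < 1 := (le_abs_self _).trans_lt (h'.trans_lt hσ1)
    have h3 : (1 - hW.isHermitian.eigenvalues j) * inner ℝ (b j) one = 0 := by
      linear_combination h
    rcases mul_eq_zero.1 h3 with h4 | h4
    · linarith
    · exact h4
  -- By Parseval, since all the other coefficients of `one` vanish. Hence `one` is a multiple of `b
  -- j₀`, and a vector of zero sum has no component along `b j₀`.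
  have hb0 : inner ℝ (b j₀) one ≠ 0 := by
    intro h0
    have h1 := b.sum_sq_norm_inner_right one
    rw [EuclideanSpace.real_norm_sq_eq] at h1
    have h2 : ∀ j, inner ℝ (b j) one = 0 := fun j => by
      by_cases hj : j = j₀
      · rw [hj, h0]
      · exact hb1 j hj
    have hM' : (0 : ℝ) < M := by exact_mod_cast (by omega : 0 < M)
    have h3 : ∑ i, one.ofLp i ^ 2 = (M : ℝ) := by simp [one]
    rw [h3] at h1
    simp only [h2, norm_zero, ne_eq, OfNat.ofNat_ne_zero, not_false_eq_true, zero_pow,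
      Finset.sum_const_zero] at h1
    linarith
  have hv0 : inner ℝ (b j₀) (WithLp.toLp 2 v) = 0 := by
    have h1 := b.sum_inner_mul_inner (WithLp.toLp 2 v) one
    rw [Finset.sum_eq_single j₀ (fun j _ hj => by rw [hb1 j hj, mul_zero]) (by simp)] at h1
    have h2 : inner ℝ (WithLp.toLp 2 v) one = 0 := by
      rw [inner_eq_sum_mul]; simpa [one] using hv
    rw [h2] at h1
    rcases mul_eq_zero.1 h1 with h3 | h3
    · rw [real_inner_comm]; exact h3
    · exact absurd h3 hb0
  have e1 := b.sum_sq_norm_inner_right (WithLp.toLp 2 (W.mulVec v))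
  have e2 := b.sum_sq_norm_inner_right (WithLp.toLp 2 v)
  rw [EuclideanSpace.real_norm_sq_eq] at e1 e2
  change _ = ∑ i, (W.mulVec v) i ^ 2 at e1
  change _ = ∑ i, v i ^ 2 at e2
  rw [← e1, ← e2, Finset.mul_sum]
  refine Finset.sum_le_sum fun j _ => ?_
  rw [hW.inner_mulVec j v]
  by_cases hj : j = j₀
  · rw [hj, hv0]; simp
  · rw [norm_mul, mul_pow, Real.norm_eq_abs]
    have := habs j hj
    gcongr

/-- The vector-valued version of `IsGossipMatrix.sum_mulVec_sq_le`. -/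
theorem IsGossipMatrix.sum_norm_sq_le {F : Type*} [NormedAddCommGroup F] [InnerProductSpace ℝ F]
    [FiniteDimensional ℝ F] (hW : IsGossipMatrix G W) (hG : G.Connected) (hM : 2 ≤ M)
    (Z : Fin M → F) (hZ : ∑ i, Z i = 0) :
    ∑ i, ‖∑ j, W i j • Z j‖ ^ 2 ≤ (1 - eigengap hW.isHermitian hM) ^ 2 * ∑ i, ‖Z i‖ ^ 2 := by
  let b := stdOrthonormalBasis ℝ F
  have h1 : ∀ Y : Fin M → F, ∑ i, ‖Y i‖ ^ 2 = ∑ k, ∑ i, inner ℝ (b k) (Y i) ^ 2 := by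
    intro Y
    rw [Finset.sum_comm]
    refine Finset.sum_congr rfl fun i _ => ?_
    rw [← b.sum_sq_norm_inner_right (Y i)]
    simp
  rw [h1, h1, Finset.mul_sum]
  refine Finset.sum_le_sum fun k _ => ?_
  have h2 := hW.sum_mulVec_sq_le hG hM (fun i => inner ℝ (b k) (Z i))
    (by rw [← inner_sum, hZ, inner_zero_right])
  refine le_trans (le_of_eq (Finset.sum_congr rfl fun i _ => ?_)) h2
  simp only [Matrix.mulVec, dotProduct, inner_sum, real_inner_smul_right]

/-- A heavy ball recurrence `x_{t+2} = 2 B x_{t+1} - q² x_t` with a symmetric `B` of norm at most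
`q` along the sequence. -/
theorem norm_le_of_momentum_recurrence {H : Type*} [NormedAddCommGroup H] [InnerProductSpace ℝ H]
    (B : H → H) (hB : ∀ u v, inner ℝ (B u) v = inner ℝ u (B v)) {q : ℝ} (hq : 0 ≤ q)
    (hq1 : q ≤ 1)     (x : ℕ → H) (hx1 : x 1 = (2 : ℝ) • B (x 0) - q ^ 2 • x 0)
    (hx : ∀ t, x (t + 2) = (2 : ℝ) • B (x (t + 1)) - q ^ 2 • x t)
    (hle : ∀ t, ‖B (x t)‖ ≤ q * ‖x t‖) (t : ℕ) :
    ‖x t‖ ≤ (2 * t + 1) * q ^ t * ‖x 0‖ := by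
  -- This quadratic form is multiplied by exactly `q ^ 2` at each step. Its initial value is at most
  -- `q² (1 + q)² ‖x 0‖²`, which is at most `(2 q ‖x 0‖) ^ 2` because `q ≤ 1`.
  have hE : ∀ t, ‖x (t + 1)‖ ^ 2 - 2 * inner ℝ (x (t + 1)) (B (x t)) + q ^ 2 * ‖x t‖ ^ 2 ≤
      (2 * q ^ (t + 1) * ‖x 0‖) ^ 2 := by
    intro t
    induction t with
    | zero =>
      have hc : |inner ℝ (x 0) (B (x 0))| ≤ ‖x 0‖ * (q * ‖x 0‖) :=
        (abs_real_inner_le_norm _ _).trans (by gcongr; exact hle 0)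
      have hc' := (abs_le.1 hc).1
      simp only [zero_add, pow_one]
      rw [hx1, ← real_inner_self_eq_norm_sq]
      simp only [inner_sub_left, inner_sub_right, real_inner_smul_left, real_inner_smul_right, hB]
      rw [real_inner_self_eq_norm_sq, ← hB (x 0) (B (x 0)), real_inner_self_eq_norm_sq]
      have h1 := mul_le_mul_of_nonneg_left hc' (mul_nonneg hq hq)
      have h2 : 0 ≤ q ^ 2 * ((1 - q) * (3 + q)) * ‖x 0‖ ^ 2 := by
        have : 0 ≤ 1 - q := by linarith
        positivity
      nlinarith
    | succ t ih =>
      have h1 : ‖x (t + 2)‖ ^ 2 - 2 * inner ℝ (x (t + 2)) (B (x (t + 1))) =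
          - (q ^ 2 * inner ℝ (x (t + 2)) (x t)) := by
        rw [← real_inner_self_eq_norm_sq]
        nth_rewrite 2 [hx t]
        simp only [inner_sub_right, real_inner_smul_right]
        ring
      have h2 : inner ℝ (x (t + 2)) (x t) =
          2 * inner ℝ (x (t + 1)) (B (x t)) - q ^ 2 * ‖x t‖ ^ 2 := by
        rw [hx t, inner_sub_left, real_inner_smul_left, real_inner_smul_left, hB,
          real_inner_self_eq_norm_sq]
      rw [show t + 1 + 1 = t + 2 from rfl, h1, h2]
      have h3 := mul_le_mul_of_nonneg_left ih (sq_nonneg q)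
      calc _ = q ^ 2 * (‖x (t + 1)‖ ^ 2 - 2 * inner ℝ (x (t + 1)) (B (x t)) +
            q ^ 2 * ‖x t‖ ^ 2) := by ring
        _ ≤ _ := h3
        _ = _ := by ring
  induction t with
  | zero => simp
  | succ t ih =>
    -- Completing the square: since `‖B (x t)‖ ≤ q ‖x t‖`, the form dominates `‖x (t + 1) - B (x t)‖
    -- ^ 2`. Each step thus adds at most `2 q ^ (t + 1) ‖x 0‖` to `q ‖x t‖`, whence the factor `2 t
    -- + 1`.
    have h1 : ‖x (t + 1) - B (x t)‖ ≤ 2 * q ^ (t + 1) * ‖x 0‖ := by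
      refine le_of_sq_le_sq (le_trans ?_ (hE t)) (by positivity)
      rw [norm_sub_sq_real]
      have := pow_le_pow_left₀ (norm_nonneg _) (hle t) 2
      rw [mul_pow] at this
      linarith
    have h2 : ‖x (t + 1)‖ ≤ ‖x (t + 1) - B (x t)‖ + ‖B (x t)‖ := by
      simpa using norm_add_le (x (t + 1) - B (x t)) (B (x t))
    have h3 := mul_le_mul_of_nonneg_left ih hq
    have h4 := hle t
    push_cast
    calc _ ≤ 2 * q ^ (t + 1) * ‖x 0‖ + q * ((2 * t + 1) * q ^ t * ‖x 0‖) := by linarith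
      _ = _ := by ring

end Gossip

/-! ### Error of accelerated gossip -/

section GossipError

variable {d M : ℕ} {G : SimpleGraph (Fin M)} {W : Matrix (Fin M) (Fin M) ℝ}

/-- The factor by which a call of accelerated gossip with parameter `H` contracts the distance to
consensus. -/
noncomputable def gossipRate (ρ : ℝ) (H : ℕ) : ℝ :=
  (2 * (H + 1 : ℕ) + 1) * Real.sqrt (momentum ρ) ^ (H + 1)

theorem gossipRate_nonneg (ρ : ℝ) (H : ℕ) : 0 ≤ gossipRate ρ H := by
  unfold gossipRate; positivity

theorem momentum_nonneg {ρ : ℝ} : 0 ≤ momentum ρ := by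
  unfold momentum
  have h0 := Real.sqrt_nonneg (1 - (1 - ρ) ^ 2)
  have h1 : Real.sqrt (1 - (1 - ρ) ^ 2) ≤ 1 := by
    rw [Real.sqrt_le_one]; nlinarith [sq_nonneg (1 - ρ)]
  exact div_nonneg (by linarith) (by linarith)

/-- The square root of the momentum is at most `exp (-√ρ / 2)`. -/
theorem sqrt_momentum_le {ρ : ℝ} (h0 : 0 < ρ) (h1 : ρ ≤ 1) :
    Real.sqrt (momentum ρ) ≤ Real.exp (-(Real.sqrt ρ) / 2) := by
  rw [Real.sqrt_le_left (Real.exp_pos _).le, ← Real.exp_nat_mul]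
  have hs : Real.sqrt ρ ≤ Real.sqrt (1 - (1 - ρ) ^ 2) := Real.sqrt_le_sqrt (by nlinarith)
  have hs1 : Real.sqrt (1 - (1 - ρ) ^ 2) ≤ 1 := by
    rw [Real.sqrt_le_one]; nlinarith [sq_nonneg (1 - ρ)]
  have hs0 := Real.sqrt_nonneg (1 - (1 - ρ) ^ 2)
  have h2 := Real.add_one_le_exp (-Real.sqrt ρ)
  have h3 : ((2 : ℕ) : ℝ) * (-Real.sqrt ρ / 2) = -Real.sqrt ρ := by push_cast; ring
  rw [h3]
  unfold momentum
  refine (div_le_self (by linarith) (by linarith)).trans (by linarith)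

/-- Half of the decay `exp (-√ρ t / 2)` is spent on the linear factor, through `2 t + 1 ≤ (12 / √ρ)
exp (√ρ t / 4)`. -/
theorem gossipRate_le {ρ : ℝ} (h0 : 0 < ρ) (h1 : ρ ≤ 1) (H : ℕ) :
    gossipRate ρ H ≤ 12 / Real.sqrt ρ * Real.exp (-(Real.sqrt ρ * (H + 1 : ℕ)) / 4) := by
  have hs : 0 < Real.sqrt ρ := Real.sqrt_pos.2 h0
  have h2 := pow_le_pow_left₀ (Real.sqrt_nonneg _) (sqrt_momentum_le h0 h1) (H + 1)
  rw [← Real.exp_nat_mul] at h2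
  have h3 := Real.add_one_le_exp (Real.sqrt ρ * (H + 1 : ℕ) / 4)
  have ht : (1 : ℝ) ≤ (H + 1 : ℕ) := by push_cast; linarith [(Nat.cast_nonneg H : (0 : ℝ) ≤ H)]
  set t : ℝ := ((H + 1 : ℕ) : ℝ) with htt
  have h4 : 2 * t + 1 ≤ 12 / Real.sqrt ρ * Real.exp (Real.sqrt ρ * t / 4) := by
    calc 2 * t + 1 ≤ 3 * t := by linarith
      _ = 12 / Real.sqrt ρ * (Real.sqrt ρ * t / 4) := by field_simp; norm_num
      _ ≤ _ := by gcongr; linarith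
  unfold gossipRate
  rw [← htt]
  calc (2 * t + 1) * Real.sqrt (momentum ρ) ^ (H + 1)
      ≤ (12 / Real.sqrt ρ * Real.exp (Real.sqrt ρ * t / 4)) *
        Real.exp (t * (-Real.sqrt ρ / 2)) := by gcongr
    _ = _ := by rw [mul_assoc, ← Real.exp_add]; congr 2; ring

theorem IsGossipMatrix.sum_sum_smul {F : Type*} [AddCommGroup F] [Module ℝ F]
    (hW : IsGossipMatrix G W) (Z : Fin M → F) : ∑ i, ∑ j, W i j • Z j = ∑ i, Z i := by
  rw [Finset.sum_comm]
  refine Finset.sum_congr rfl fun j _ => ?_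
  rw [← Finset.sum_smul, hW.colSum, one_smul]

/-- The columns of `W` sum to `1` and `(1 + η) - η = 1`, so sums are invariant. -/
theorem IsGossipMatrix.sum_gossipSeq (hW : IsGossipMatrix G W) (η : ℝ) (Z : Fin M → V d) (t : ℕ) :
    ∑ i, (gossipSeq W η Z t).1 i = ∑ i, Z i ∧ ∑ i, (gossipSeq W η Z t).2 i = ∑ i, Z i := by
  induction t with
  | zero => exact ⟨rfl, rfl⟩
  | succ t ih =>
    refine ⟨?_, ih.1⟩
    simp only [gossipSeq, Finset.sum_sub_distrib, ← Finset.smul_sum, hW.sum_sum_smul, ih.1, ih.2]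
    module

/-- Accelerated gossip preserves the average and contracts the deviation from it. -/
theorem IsGossipMatrix.sum_norm_sq_accGossip_sub_le (hW : IsGossipMatrix G W) (hG : G.Connected)
    (hM : 2 ≤ M) (Z : Fin M → V d) (H : ℕ) :
    ∑ i, ‖accGossip W (momentum (eigengap hW.isHermitian hM)) H Z i - avgPoint Z‖ ^ 2 ≤
      gossipRate (eigengap hW.isHermitian hM) H ^ 2 * ∑ i, ‖Z i - avgPoint Z‖ ^ 2 := by
  set ρ := eigengap hW.isHermitian hM with hρ
  obtain ⟨hρ0, hρ1⟩ := hW.eigengap_mem hG hM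
  rw [← hρ] at hρ0 hρ1
  set η := momentum ρ with hη
  have hη0 : 0 ≤ η := momentum_nonneg
  set s := Real.sqrt (1 - (1 - ρ) ^ 2) with hs
  have hs0 : 0 ≤ s := Real.sqrt_nonneg _
  have hs2 : s ^ 2 = 1 - (1 - ρ) ^ 2 := Real.sq_sqrt (by nlinarith)
  have hs1 : s ≤ 1 := by nlinarith [sq_nonneg (1 - ρ)]
  have hηs : η = (1 - s) / (1 + s) := rfl
  have hη1 : (1 + η) / 2 = 1 / (1 + s) := by rw [hηs]; field_simp; ring
  have hq : Real.sqrt η ^ 2 = η := Real.sq_sqrt hη0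
  have hq1 : Real.sqrt η ≤ 1 := by
    rw [Real.sqrt_le_one, hηs, div_le_one (by linarith)]; linarith
  -- Critical damping: the momentum is defined so that this is an equality. It makes `(1 + η) / 2 ·
  -- W` a symmetric map of norm at most `√η` on deviations of zero sum, as the recurrence lemma
  -- requires with `q = √η`.
  have hq2 : (1 + η) / 2 * (1 - ρ) ≤ Real.sqrt η := by
    refine Real.le_sqrt_of_sq_le ?_
    rw [hη1, hηs, mul_pow, ← sub_eq_iff_eq_add'.2 (sub_eq_iff_eq_add.1 hs2.symm)]
    apply le_of_eq
    field_simp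
    ring
  set c := avgPoint Z with hc
  have hMpos : (0 : ℝ) < M := by exact_mod_cast (by omega : 0 < M)
  have hsum0 : ∀ t, ∑ i, ((gossipSeq W η Z t).1 i - c) = 0 := by
    intro t
    rw [Finset.sum_sub_distrib, (hW.sum_gossipSeq η Z t).1, Finset.sum_const, Finset.card_univ,
      Fintype.card_fin, hc, avgPoint, ← Nat.cast_smul_eq_nsmul ℝ, smul_smul,
      mul_one_div_cancel hMpos.ne', one_smul, sub_self]
  let B : PiLp 2 (fun _ : Fin M => V d) → PiLp 2 (fun _ : Fin M => V d) := fun x =>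
    WithLp.toLp 2 (fun i => ((1 + η) / 2) • ∑ j, W i j • x.ofLp j)
  let x : ℕ → PiLp 2 (fun _ : Fin M => V d) := fun t =>
    WithLp.toLp 2 (fun i => (gossipSeq W η Z t).1 i - c)
  have hWc : ∀ i, ∑ j, W i j • c = c := fun i => by
    rw [← Finset.sum_smul, hW.stochastic, one_smul]
  have hxs : ∀ t, x (t + 1) = (2 : ℝ) • B (x t) - Real.sqrt η ^ 2 •
      (WithLp.toLp 2 (fun i => (gossipSeq W η Z t).2 i - c) : PiLp 2 (fun _ : Fin M => V d)) := by
    intro t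
    rw [hq]
    ext1 i
    change (gossipSeq W η Z (t + 1)).1 i - c = (2 : ℝ) • (((1 + η) / 2) • ∑ j, W i j •
      ((gossipSeq W η Z t).1 j - c)) - η • ((gossipSeq W η Z t).2 i - c)
    simp only [smul_sub, Finset.sum_sub_distrib, hWc]
    simp only [gossipSeq]
    module
  have h := norm_le_of_momentum_recurrence B ?_ (Real.sqrt_nonneg η) hq1 x (hxs 0)
    (fun t => hxs (t + 1)) ?_ (H + 1)
  · have h2 := pow_le_pow_left₀ (norm_nonneg _) h 2
    rw [mul_pow, PiLp.norm_sq_eq_of_L2, PiLp.norm_sq_eq_of_L2] at h2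
    exact h2
  · intro u v
    rw [PiLp.inner_apply, PiLp.inner_apply]
    simp only [B, real_inner_smul_left, real_inner_smul_right, inner_sum, sum_inner,
      ← Finset.mul_sum]
    congr 1
    rw [Finset.sum_comm]
    exact Finset.sum_congr rfl fun i _ => Finset.sum_congr rfl fun j _ => by
      rw [hW.apply_comm j i]
  · intro t
    refine le_of_sq_le_sq ?_ (by positivity)
    have h2 := hW.sum_norm_sq_le hG hM _ (hsum0 t)
    rw [← hρ] at h2
    have e1 : ‖B (x t)‖ ^ 2 = ((1 + η) / 2) ^ 2 *
        ∑ i, ‖∑ j, W i j • ((gossipSeq W η Z t).1 j - c)‖ ^ 2 := by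
      rw [PiLp.norm_sq_eq_of_L2, Finset.mul_sum]
      refine Finset.sum_congr rfl fun i _ => ?_
      change ‖((1 + η) / 2) • ∑ j, W i j • ((gossipSeq W η Z t).1 j - c)‖ ^ 2 = _
      rw [norm_smul, mul_pow, Real.norm_eq_abs, sq_abs]
    have e2 : ‖x t‖ ^ 2 = ∑ i, ‖(gossipSeq W η Z t).1 i - c‖ ^ 2 := PiLp.norm_sq_eq_of_L2 _ _
    rw [e1, mul_pow, e2]
    calc _ ≤ ((1 + η) / 2) ^ 2 * ((1 - ρ) ^ 2 * ∑ i, ‖(gossipSeq W η Z t).1 i - c‖ ^ 2) := by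
            gcongr
      _ = ((1 + η) / 2 * (1 - ρ)) ^ 2 * ∑ i, ‖(gossipSeq W η Z t).1 i - c‖ ^ 2 := by ring
      _ ≤ _ := by
        have : 0 ≤ (1 + η) / 2 * (1 - ρ) := mul_nonneg (by linarith) (by linarith)
        gcongr

theorem sum_norm_sub_avgPoint_sq_le (hM : 0 < M) (Z : Fin M → V d) :
    ∑ i, ‖Z i - avgPoint Z‖ ^ 2 ≤ ∑ i, ‖Z i‖ ^ 2 := by
  have hMpos : (0 : ℝ) < M := by exact_mod_cast hM
  have h1 : ∑ i, Z i = (M : ℝ) • avgPoint Z := by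
    rw [avgPoint, smul_smul, mul_one_div_cancel hMpos.ne', one_smul]
  have h2 : ∑ i, inner ℝ (Z i) (avgPoint Z) = M * ‖avgPoint Z‖ ^ 2 := by
    rw [← sum_inner, h1, real_inner_smul_left, real_inner_self_eq_norm_sq]
  simp only [norm_sub_sq_real, Finset.sum_add_distrib, Finset.sum_sub_distrib, ← Finset.mul_sum, h2,
    Finset.sum_const, Finset.card_univ, Fintype.card_fin, nsmul_eq_mul]
  nlinarith [mul_nonneg hMpos.le (sq_nonneg ‖avgPoint Z‖)]

/-- Accelerated gossip of vectors bounded by `R`. -/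
theorem IsGossipMatrix.norm_accGossip_sub_le (hW : IsGossipMatrix G W) (hG : G.Connected)
    (hM : 2 ≤ M) (Z : Fin M → V d) (H : ℕ) {R : ℝ} (hR : ∑ i, ‖Z i‖ ^ 2 ≤ R ^ 2) (hR0 : 0 ≤ R)
    (i : Fin M) :
    ‖accGossip W (momentum (eigengap hW.isHermitian hM)) H Z i - avgPoint Z‖ ≤
      gossipRate (eigengap hW.isHermitian hM) H * R := by
  refine le_of_sq_le_sq ?_ (mul_nonneg (gossipRate_nonneg _ _) hR0)
  rw [mul_pow]
  calc _ ≤ ∑ i, ‖accGossip W (momentum (eigengap hW.isHermitian hM)) H Z i - avgPoint Z‖ ^ 2 :=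
        Finset.single_le_sum (f := fun i => ‖accGossip W (momentum (eigengap hW.isHermitian hM)) H
          Z i - avgPoint Z‖ ^ 2) (fun _ _ => sq_nonneg _) (Finset.mem_univ i)
    _ ≤ _ := hW.sum_norm_sq_accGossip_sub_le hG hM Z H
    _ ≤ _ := by
      gcongr
      exact (sum_norm_sub_avgPoint_sq_le (by omega) Z).trans hR

/-- Propagation of a vector reaches every node up to the gossip error. -/
theorem IsGossipMatrix.norm_spread_sub_le (hW : IsGossipMatrix G W) (hG : G.Connected)
    (hM : 2 ≤ M) (m : Fin M) (a : V d) (H : ℕ) (i : Fin M) :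
    ‖spread W (momentum (eigengap hW.isHermitian hM)) H m a i - a‖ ≤
      gossipRate (eigengap hW.isHermitian hM) H * (M * ‖a‖) := by
  have hMpos : (0 : ℝ) < M := by exact_mod_cast (by omega : 0 < M)
  have hsum : ∑ i, ‖(Pi.single m a : Fin M → V d) i‖ ^ 2 ≤ ‖a‖ ^ 2 := by
    rw [Finset.sum_eq_single m (fun j _ hj => by rw [Pi.single_eq_of_ne hj]; simp) (by simp)]
    simp
  have h := hW.norm_accGossip_sub_le hG hM (Pi.single m a) H hsum (norm_nonneg _) i
  have havg : (M : ℝ) • avgPoint (Pi.single m a : Fin M → V d) = a := by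
    rw [avgPoint, smul_smul, mul_one_div_cancel hMpos.ne', one_smul]
    rw [Finset.sum_eq_single m (fun j _ hj => by rw [Pi.single_eq_of_ne hj]) (by simp)]
    simp
  nth_rewrite 2 [← havg]
  rw [spread, ← smul_sub, norm_smul, Real.norm_of_nonneg hMpos.le]
  calc _ ≤ (M : ℝ) * _ := mul_le_mul_of_nonneg_left h hMpos.le
    _ = _ := by ring

end GossipError

/-! ### Projections, saddle points and variational inequalities -/

section Convexity

variable {d M : ℕ} {X Y : Set (E d)}

theorem proj_spec {S : Set (V d)} (hS : IsCompact S) (hne : S.Nonempty) (z : V d) :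
    proj S z ∈ S ∧ ∀ w ∈ S, ‖z - proj S z‖ ≤ ‖z - w‖ := by
  obtain ⟨p, hp, hmin⟩ := hS.exists_isMinOn hne
    (f := fun w => ‖z - w‖) (by fun_prop)
  exact Classical.epsilon_spec (p := fun p => p ∈ S ∧ ∀ w ∈ S, ‖z - p‖ ≤ ‖z - w‖)
    ⟨p, hp, fun w hw => hmin hw⟩

theorem proj_mem {S : Set (V d)} (hS : IsCompact S) (hne : S.Nonempty) (z : V d) :
    proj S z ∈ S := (proj_spec hS hne z).1

theorem inner_sub_proj_le {S : Set (V d)} (hS : IsCompact S) (hc : Convex ℝ S) (z : V d) {w : V d}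
    (hw : w ∈ S) : inner ℝ (z - proj S z) (w - proj S z) ≤ 0 := by
  have hne : S.Nonempty := ⟨w, hw⟩
  have h := proj_spec hS hne z
  have : Nonempty S := ⟨⟨w, hw⟩⟩
  refine (norm_eq_iInf_iff_real_inner_le_zero hc h.1).1 (le_antisymm ?_ ?_) w hw
  · exact le_ciInf fun w => h.2 w w.2
  · exact ciInf_le ⟨0, by rintro _ ⟨w, rfl⟩; exact norm_nonneg _⟩ (⟨proj S z, h.1⟩ : S)

/-- Add the obtuse-angle inequalities at the two projections and apply Cauchy-Schwarz. -/
theorem norm_proj_sub_proj_le {S : Set (V d)} (hS : IsCompact S) (hc : Convex ℝ S)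
    (hne : S.Nonempty) (z w : V d) : ‖proj S z - proj S w‖ ≤ ‖z - w‖ := by
  have h1 := inner_sub_proj_le hS hc z (proj_mem hS hne w)
  have h2 := inner_sub_proj_le hS hc w (proj_mem hS hne z)
  set p := proj S z
  set q := proj S w
  have h3 : ‖p - q‖ ^ 2 ≤ inner ℝ (z - w) (p - q) := by
    rw [← real_inner_self_eq_norm_sq]
    have e1 : inner ℝ (p - q) (p - q) = inner ℝ (z - w) (p - q) + inner ℝ (z - p) (q - p)
        + inner ℝ (w - q) (p - q) := by
      simp only [inner_sub_left, inner_sub_right]; ring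
    linarith
  have h4 := real_inner_le_norm (z - w) (p - q)
  by_contra! h5
  have : 0 ≤ ‖z - w‖ := norm_nonneg _
  nlinarith

theorem proj_eq_self {S : Set (V d)} (hS : IsCompact S) {w : V d} (hw : w ∈ S) :
    proj S w = w := by
  have h := (proj_spec hS ⟨w, hw⟩ w).2 w hw
  rw [sub_self, norm_zero] at h
  exact (sub_eq_zero.1 (norm_le_zero_iff.1 h)).symm

theorem norm_proj_sub_le {S : Set (V d)} (hS : IsCompact S) (hc : Convex ℝ S) (z : V d) {w : V d}
    (hw : w ∈ S) : ‖proj S z - w‖ ≤ ‖z - w‖ := by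
  have h := norm_proj_sub_proj_le hS hc ⟨w, hw⟩ z w
  rwa [proj_eq_self hS hw] at h

theorem isCompact_feasible (hX : IsCompact X) (hY : IsCompact Y) : IsCompact (feasible X Y) := by
  have h : feasible X Y =
      (WithLp.prodContinuousLinearEquiv 2 ℝ (E d) (E d)).toHomeomorph ⁻¹' (X ×ˢ Y) := rfl
  rw [h, Homeomorph.isCompact_preimage]
  exact hX.prod hY

theorem convex_feasible (hX : Convex ℝ X) (hY : Convex ℝ Y) : Convex ℝ (feasible X Y) :=
  (hX.prod hY).linear_preimage
    (WithLp.prodContinuousLinearEquiv 2 ℝ (E d) (E d)).toLinearEquiv.toLinearMap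

theorem inner_pair_fst_snd (g w : V d) :
    inner ℝ g w = inner ℝ g.fst w.fst + inner ℝ g.snd w.snd := WithLp.prod_inner_apply g w

theorem inner_spOp (φ : V d → ℝ) (z w : V d) :
    inner ℝ (spOp φ z) w =
      inner ℝ (gradient φ z).fst w.fst - inner ℝ (gradient φ z).snd w.snd := by
  rw [inner_pair_fst_snd]
  change inner ℝ (gradient φ z).fst w.fst + inner ℝ (-(gradient φ z).snd) w.snd = _
  rw [inner_neg_left]; ring

/-- The first-order condition of a minimum over a convex set. -/
theorem inner_gradient_nonneg_of_isMinOn {F : Type*} [NormedAddCommGroup F] [InnerProductSpace ℝ F]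
    [CompleteSpace F] {φ : F → ℝ} {S : Set F} (hS : Convex ℝ S) {z w : F} (hz : z ∈ S)
    (hw : w ∈ S) (hφ : DifferentiableAt ℝ φ z) (hmin : IsMinOn φ S z) :
    0 ≤ inner ℝ (gradient φ z) (w - z) := by
  have h := hmin.localize.hasFDerivWithinAt_nonneg
    (hφ.hasGradientAt.hasFDerivAt.hasFDerivWithinAt)
    (mem_posTangentConeAt_of_segment_subset (y := w - z) (by
      rw [add_sub_cancel]; exact hS.segment_subset hz hw))
  simpa using h

/-- The converse of `inner_gradient_nonneg_of_isMinOn` for a function with monotone gradient. -/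
theorem le_of_inner_gradient_nonneg {F : Type*} [NormedAddCommGroup F] [InnerProductSpace ℝ F]
    [CompleteSpace F] {φ : F → ℝ} {p w : F}
    (hφ : ∀ q ∈ segment ℝ p w, DifferentiableAt ℝ φ q)
    (hmono : ∀ q ∈ segment ℝ p w, 0 ≤ inner ℝ (gradient φ q - gradient φ p) (q - p))
    (h0 : 0 ≤ inner ℝ (gradient φ p) (w - p)) : φ p ≤ φ w := by
  -- The increment of `φ` equals the slope at some `q` on the segment, which monotonicity bounds
  -- below by the slope at `p`.
  obtain ⟨q, hq, h⟩ := domain_mvt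
    (fun x hx => (hφ x hx).hasGradientAt.hasFDerivAt.hasFDerivWithinAt)
    (convex_segment p w) (left_mem_segment ℝ p w) (right_mem_segment ℝ p w)
  simp only [InnerProductSpace.toDual_apply_apply] at h
  have h1 := hmono q hq
  rw [segment_eq_image'] at hq
  obtain ⟨t, ⟨ht0, -⟩, rfl⟩ := hq
  rcases ht0.eq_or_lt with rfl | ht
  · simp only [zero_smul, add_zero] at h
    linarith
  · rw [add_sub_cancel_left, real_inner_smul_right, inner_sub_left] at h1
    have h2 := nonneg_of_mul_nonneg_right h1 ht
    linarith

theorem gradient_fun_neg {F : Type*} [NormedAddCommGroup F] [InnerProductSpace ℝ F]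
    [CompleteSpace F] (φ : F → ℝ) (z : F) : gradient (fun u => - φ u) z = - gradient φ z := by
  simp only [gradient, fderiv_fun_neg, map_neg]

/-- A saddle point minimizes `φ` on the slice with its `y` fixed and `-φ` on the slice with its `x`
fixed; the two first-order conditions add up to the variational inequality. -/
theorem IsSolution.inner_nonneg (hX : Convex ℝ X) (hY : Convex ℝ Y) {φ : V d → ℝ} {z w : V d}
    (h : IsSolution X Y φ z) (hφ : DifferentiableAt ℝ φ z) (hw : w ∈ feasible X Y) :
    0 ≤ inner ℝ (spOp φ z) (w - z) := by
  obtain ⟨hz, hs⟩ := h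
  have hx : 0 ≤ inner ℝ (gradient φ z) (pair w.fst z.snd - z) := by
    refine inner_gradient_nonneg_of_isMinOn (S := feasible X {z.snd})
      (convex_feasible hX (convex_singleton _)) ⟨hz.1, rfl⟩ ⟨hw.1, rfl⟩ hφ ?_
    rintro u ⟨hu1, hu2⟩
    have h1 := hs u.fst hu1 z.snd hz.2
    have h2 : pair u.fst z.snd = u := by rw [← Set.mem_singleton_iff.1 hu2]; rfl
    change φ z ≤ φ u
    rw [← h2]; exact h1
  have hy : 0 ≤ inner ℝ (gradient (fun u => - φ u) z) (pair z.fst w.snd - z) := by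
    refine inner_gradient_nonneg_of_isMinOn (S := feasible {z.fst} Y)
      (convex_feasible (convex_singleton _) hY) ⟨rfl, hz.2⟩ ⟨rfl, hw.2⟩ hφ.neg ?_
    rintro u ⟨hu1, hu2⟩
    have h1 := hs z.fst hz.1 u.snd hu2
    have h2 : pair z.fst u.snd = u := by rw [← Set.mem_singleton_iff.1 hu1]; rfl
    change φ (pair z.fst u.snd) ≤ φ z at h1
    rw [h2] at h1
    exact neg_le_neg h1
  rw [gradient_fun_neg, inner_neg_left, inner_pair_fst_snd] at hy
  rw [inner_pair_fst_snd] at hx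
  rw [inner_spOp]
  have e1 : (pair w.fst z.snd - z).snd = 0 := sub_self z.snd
  have e2 : (pair z.fst w.snd - z).fst = 0 := sub_self z.fst
  have e3 : (pair w.fst z.snd - z).fst = (w - z).fst := rfl
  have e4 : (pair z.fst w.snd - z).snd = (w - z).snd := rfl
  rw [e1, e3, inner_zero_right] at hx
  rw [e2, e4, inner_zero_right] at hy
  linarith

/-- Moving only `x` or only `y` splits the variational inequality into two first-order conditions.
Monotonicity on each slice makes them sufficient for a minimum of `φ` and of `-φ`. -/
theorem isSolution_of_inner_nonneg (hX : Convex ℝ X) (hY : Convex ℝ Y) {φ : V d → ℝ} {z : V d}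
    (hz : z ∈ feasible X Y) (hφ : ∀ w ∈ feasible X Y, DifferentiableAt ℝ φ w)
    (hmono : ∀ z₁ ∈ feasible X Y, ∀ z₂ ∈ feasible X Y,
      0 ≤ inner ℝ (spOp φ z₁ - spOp φ z₂) (z₁ - z₂))
    (h : ∀ w ∈ feasible X Y, 0 ≤ inner ℝ (spOp φ z) (w - z)) : IsSolution X Y φ z := by
  refine ⟨hz, fun x hx y hy => ?_⟩
  have hc := convex_feasible hX hY
  have hfst : ∀ {p w q : V d}, p.snd = w.snd → q ∈ segment ℝ p w → q.snd = p.snd := by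
    intro p w q hpw hq
    rw [segment_eq_image'] at hq
    obtain ⟨t, -, rfl⟩ := hq
    change p.snd + t • (w.snd - p.snd) = p.snd
    rw [hpw, sub_self, smul_zero, add_zero]
  have hsnd : ∀ {p w q : V d}, p.fst = w.fst → q ∈ segment ℝ p w → q.fst = p.fst := by
    intro p w q hpw hq
    rw [segment_eq_image'] at hq
    obtain ⟨t, -, rfl⟩ := hq
    change p.fst + t • (w.fst - p.fst) = p.fst
    rw [hpw, sub_self, smul_zero, add_zero]
  have hxle : φ z ≤ φ (pair x z.snd) := by
    have hw : pair x z.snd ∈ feasible X Y := ⟨hx, hz.2⟩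
    refine le_of_inner_gradient_nonneg (fun q hq => hφ q (hc.segment_subset hz hw hq))
      (fun q hq => ?_) ?_
    · have h1 := hmono q (hc.segment_subset hz hw hq) z hz
      have h2 : (q - z).snd = 0 := sub_eq_zero.2 (hfst (p := z) (w := pair x z.snd) rfl hq)
      rw [inner_sub_left, inner_spOp, inner_spOp, h2, inner_zero_right, inner_zero_right] at h1
      rw [inner_sub_left, inner_pair_fst_snd, inner_pair_fst_snd, h2, inner_zero_right,
        inner_zero_right]
      linarith
    · have h1 := h _ hw
      have h2 : (pair x z.snd - z).snd = 0 := sub_self z.snd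
      rw [inner_spOp, h2, inner_zero_right] at h1
      rw [inner_pair_fst_snd, h2, inner_zero_right]
      linarith
  have hyle : -φ z ≤ -φ (pair z.fst y) := by
    have hw : pair z.fst y ∈ feasible X Y := ⟨hz.1, hy⟩
    refine le_of_inner_gradient_nonneg (φ := fun u => - φ u)
      (fun q hq => (hφ q (hc.segment_subset hz hw hq)).neg) (fun q hq => ?_) ?_
    · have h1 := hmono q (hc.segment_subset hz hw hq) z hz
      have h2 : (q - z).fst = 0 := sub_eq_zero.2 (hsnd (p := z) (w := pair z.fst y) rfl hq)
      rw [gradient_fun_neg, gradient_fun_neg]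
      rw [inner_sub_left, inner_spOp, inner_spOp, h2, inner_zero_right, inner_zero_right] at h1
      rw [inner_sub_left, inner_neg_left, inner_neg_left, inner_pair_fst_snd, inner_pair_fst_snd,
        h2, inner_zero_right, inner_zero_right]
      linarith
    · have h1 := h _ hw
      have h2 : (pair z.fst y - z).fst = 0 := sub_self z.fst
      rw [gradient_fun_neg]
      rw [inner_spOp, h2, inner_zero_right] at h1
      rw [inner_neg_left, inner_pair_fst_snd, h2, inner_zero_right]
      linarith
  change φ (pair z.fst y) ≤ φ (pair x z.snd)
  linarith

theorem hasGradientAt_subObj {γ : ℝ} {φ : V d → ℝ} {v u : V d} (hφ : DifferentiableAt ℝ φ u) :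
    HasGradientAt (subObj γ φ v)
      (γ • gradient φ u + pair (u.fst - v.fst) (-(u.snd - v.snd))) u := by
  rw [hasGradientAt_iff_hasFDerivAt]
  have h1 := hφ.hasGradientAt.hasFDerivAt
  have h2 : HasFDerivAt (fun w : V d => w.fst - v.fst) (WithLp.fstL 2 ℝ (E d) (E d)) u :=
    (WithLp.fstL 2 ℝ (E d) (E d)).hasFDerivAt.sub_const _
  have h3 : HasFDerivAt (fun w : V d => w.snd - v.snd) (WithLp.sndL 2 ℝ (E d) (E d)) u :=
    (WithLp.sndL 2 ℝ (E d) (E d)).hasFDerivAt.sub_const _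
  have h4 := ((h1.const_mul γ).add (h2.norm_sq.const_mul (1 / 2))).sub (h3.norm_sq.const_mul (1 / 2))
  refine h4.congr_fderiv ?_
  ext w
  simp [pair, inner_sub_left]
  ring

theorem spOp_subObj {γ : ℝ} {φ : V d → ℝ} {v u : V d} (hφ : DifferentiableAt ℝ φ u) :
    spOp (subObj γ φ v) u = subOp γ φ v u := by
  unfold spOp subOp
  rw [(hasGradientAt_subObj hφ).gradient]
  refine WithLp.ofLp_injective 2 (Prod.ext ?_ ?_)
  · change γ • (gradient φ u).fst + (u.fst - v.fst) = γ • (gradient φ u).fst + u.fst - v.fst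
    module
  · change -(γ • (gradient φ u).snd + -(u.snd - v.snd)) =
      γ • (-(gradient φ u).snd) + u.snd - v.snd
    module

end Convexity

/-! ### Solvability of the subproblems and Extragradient -/

section Extragradient

variable {d M : ℕ} {X Y : Set (E d)}

/-- A strongly monotone Lipschitz operator on a compact convex set has a solution of its
variational inequality. -/
theorem exists_inner_nonneg {S : Set (V d)} (hS : IsCompact S) (hc : Convex ℝ S)
    (hne : S.Nonempty) {A : V d → V d} {l : ℝ} (hl : 1 ≤ l)
    (hmono : ∀ z ∈ S, ∀ w ∈ S, ‖z - w‖ ^ 2 ≤ inner ℝ (A z - A w) (z - w))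
    (hlip : ∀ z ∈ S, ∀ w ∈ S, ‖A z - A w‖ ≤ l * ‖z - w‖) :
    ∃ p ∈ S, ∀ w ∈ S, 0 ≤ inner ℝ (A p) (w - p) := by
  have hl0 : 0 < l := by linarith
  -- With step `1 / l ^ 2` the squared factor is `1 - 2 / l ^ 2 + 1 / l ^ 2 < 1`. The fixed point of
  -- this contraction solves the inequality by the obtuse-angle property of the projection.
  let T : V d → V d := fun u => proj S (u - (1 / l ^ 2) • A u)
  have hT : Set.MapsTo T S S := fun u _ => proj_mem hS hne _
  have hK : 0 ≤ 1 - 1 / l ^ 2 := by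
    rw [sub_nonneg, div_le_one (by positivity)]; nlinarith
  have hcontr : ∀ u ∈ S, ∀ w ∈ S, ‖T u - T w‖ ≤ Real.sqrt (1 - 1 / l ^ 2) * ‖u - w‖ := by
    intro u hu w hw
    refine (norm_proj_sub_proj_le hS hc hne _ _).trans ?_
    refine le_of_sq_le_sq ?_ (by positivity)
    rw [mul_pow, Real.sq_sqrt hK]
    have e : u - (1 / l ^ 2) • A u - (w - (1 / l ^ 2) • A w) =
        (u - w) - (1 / l ^ 2) • (A u - A w) := by module
    rw [e, norm_sub_sq_real, real_inner_smul_right, norm_smul, mul_pow,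
      Real.norm_of_nonneg (by positivity)]
    have h1 := hmono u hu w hw
    have h2 := pow_le_pow_left₀ (norm_nonneg _) (hlip u hu w hw) 2
    rw [real_inner_comm] at h1
    have h3 : (1 / l ^ 2) ^ 2 * ‖A u - A w‖ ^ 2 ≤ (1 / l ^ 2) * ‖u - w‖ ^ 2 := by
      calc _ ≤ (1 / l ^ 2) ^ 2 * (l * ‖u - w‖) ^ 2 := by gcongr
        _ = _ := by field_simp
    have h4 := mul_le_mul_of_nonneg_left h1 (by positivity : 0 ≤ 1 / l ^ 2)
    nlinarith
  have hKlt : Real.sqrt (1 - 1 / l ^ 2) < 1 := by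
    rw [Real.sqrt_lt' one_pos]
    have : 0 < 1 / l ^ 2 := by positivity
    linarith
  have hcw : ContractingWith ⟨Real.sqrt (1 - 1 / l ^ 2), Real.sqrt_nonneg _⟩
      (Set.MapsTo.restrict T S S hT) := by
    refine ⟨by exact_mod_cast hKlt, LipschitzWith.of_dist_le_mul fun u w => ?_⟩
    rw [Subtype.dist_eq, Subtype.dist_eq, dist_eq_norm, dist_eq_norm]
    exact hcontr u u.2 w w.2
  obtain ⟨x₀, hx₀⟩ := hne
  obtain ⟨p, hp, hfix, -⟩ := ContractingWith.exists_fixedPoint' hS.isComplete hT hcw hx₀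
    (edist_ne_top _ _)
  refine ⟨p, hp, fun w hw => ?_⟩
  have h := inner_sub_proj_le hS hc (p - (1 / l ^ 2) • A p) hw
  rw [show proj S (p - (1 / l ^ 2) • A p) = p from hfix] at h
  have e : p - (1 / l ^ 2) • A p - p = -((1 / l ^ 2) • A p) := by module
  rw [e, inner_neg_left, real_inner_smul_left, neg_nonpos] at h
  exact nonneg_of_mul_nonneg_right h (by positivity)

/-- One step of Extragradient contracts the squared distance to the solution. -/
theorem norm_sq_extragradient_step_le {F : Type*} [NormedAddCommGroup F] [InnerProductSpace ℝ F]
    {S : Set F} {A : F → F} {l : ℝ} (hl : 1 ≤ l)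
    (hmono : ∀ z ∈ S, ∀ w ∈ S, ‖z - w‖ ^ 2 ≤ inner ℝ (A z - A w) (z - w))
    (hlip : ∀ z ∈ S, ∀ w ∈ S, ‖A z - A w‖ ≤ l * ‖z - w‖) {p u w u' : F}
    (hp : p ∈ S) (hsol : ∀ w ∈ S, 0 ≤ inner ℝ (A p) (w - p)) (hu : u ∈ S) (hw : w ∈ S)
    (hw' : inner ℝ (u - (1 / (4 * l)) • A u - w) (u' - w) ≤ 0)
    (hu'' : inner ℝ (u - (1 / (4 * l)) • A w - u') (p - u') ≤ 0) :
    ‖u' - p‖ ^ 2 ≤ (1 - 1 / (4 * l)) * ‖u - p‖ ^ 2 := by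
  have hl0 : 0 < l := by linarith
  set τ := 1 / (4 * l) with hτ
  have hτ0 : 0 < τ := by positivity
  have hτl : τ * l = 1 / 4 := by rw [hτ]; field_simp
  have hτ1 : τ ≤ 1 / 4 := by
    rw [← hτl]; nlinarith
  have h1 := hsol w hw
  have h2 := hmono w hw p hp
  have h3 : inner ℝ (A w - A u) (w - u') ≤ (l * ‖u - w‖) * ‖w - u'‖ := by
    refine (real_inner_le_norm _ _).trans ?_
    gcongr
    rw [norm_sub_rev u w]
    exact hlip w hw u hu
  have h4 : ‖u - p‖ ^ 2 ≤ 2 * ‖u - w‖ ^ 2 + 2 * ‖w - p‖ ^ 2 := by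
    have : ‖u - p‖ ≤ ‖u - w‖ + ‖w - p‖ := norm_sub_le_norm_sub_add_norm_sub u w p
    nlinarith [sq_nonneg (‖u - w‖ - ‖w - p‖), norm_nonneg (u - p), norm_nonneg (u - w),
      norm_nonneg (w - p)]
  -- Both projection terms and the last term have a favourable sign. The Lipschitz term is absorbed
  -- by `‖u - w‖ ^ 2` and `‖w - u'‖ ^ 2` since `τ l = 1 / 4`; the strong monotonicity term is
  -- transferred from `w` to `u` by `h4`.
  have e1 : ‖u' - p‖ ^ 2 = ‖u - p‖ ^ 2 - ‖u - w‖ ^ 2 - ‖w - u'‖ ^ 2 +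
      2 * inner ℝ (u - τ • A u - w) (u' - w) + 2 * inner ℝ (u - τ • A w - u') (p - u') +
      2 * τ * inner ℝ (A w - A u) (w - u') - 2 * τ * inner ℝ (A w - A p) (w - p) -
      2 * τ * inner ℝ (A p) (w - p) := by
    simp only [← real_inner_self_eq_norm_sq, inner_sub_left, inner_sub_right, real_inner_smul_left,
      real_inner_comm u' p, real_inner_comm u p, real_inner_comm u w,
      real_inner_comm w u']
    ring
  have h5 := mul_le_mul_of_nonneg_left h3 hτ0.le
  have h6 := mul_le_mul_of_nonneg_left h1 hτ0.le
  have h7 := mul_le_mul_of_nonneg_left h2 hτ0.le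
  have h8 : τ * (l * ‖u - w‖ * ‖w - u'‖) = 1 / 4 * (‖u - w‖ * ‖w - u'‖) := by
    rw [← hτl]; ring
  have h9 := mul_le_mul_of_nonneg_left h4 hτ0.le
  have h10 : τ * ‖u - w‖ ^ 2 ≤ 1 / 4 * ‖u - w‖ ^ 2 := by gcongr
  nlinarith [sq_nonneg (1 / 4 * ‖u - w‖ - ‖w - u'‖), sq_nonneg ‖u - w‖]

section Subproblem

variable {f : Fin M → V d → ℝ} {L μ r γ : ℝ}

theorem IsSmoothSaddleProblem.differentiableAt (hP : IsSmoothSaddleProblem X Y f L μ r) (m : Fin M)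
    {z : V d} (hz : z ∈ feasible X Y) : DifferentiableAt ℝ (f m) z := by
  obtain ⟨U, hU, hZU, h1, -⟩ := hP.twiceDiff m
  exact h1.differentiableAt (hU.mem_nhds (hZU hz))

theorem IsSmoothSaddleProblem.isCompact (hP : IsSmoothSaddleProblem X Y f L μ r) :
    IsCompact (feasible X Y) := isCompact_feasible hP.compactX hP.compactY

theorem IsSmoothSaddleProblem.convex (hP : IsSmoothSaddleProblem X Y f L μ r) :
    Convex ℝ (feasible X Y) := convex_feasible hP.convexX hP.convexY

theorem mem_thickening_feasible (hr : 0 < r) {z : V d} (hz : z ∈ feasible X Y) : z ∈ Metric.thickening r (feasible X Y) :=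
  Metric.self_subset_thickening hr _ hz

theorem IsSmoothSaddleProblem.subOp_stronglyMonotone (hP : IsSmoothSaddleProblem X Y f L μ r)
    (hγ : 0 ≤ γ) (m : Fin M) (v : V d) {z w : V d} (hz : z ∈ feasible X Y)
    (hw : w ∈ feasible X Y) :
    ‖z - w‖ ^ 2 ≤ inner ℝ (subOp γ (f m) v z - subOp γ (f m) v w) (z - w) := by
  have e : subOp γ (f m) v z - subOp γ (f m) v w =
      γ • (spOp (f m) z - spOp (f m) w) + (z - w) := by
    unfold subOp; module
  rw [e, inner_add_left, real_inner_smul_left, real_inner_self_eq_norm_sq]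
  have := mul_nonneg hγ (hP.monotone m z hz w hw)
  linarith

theorem IsSmoothSaddleProblem.subOp_lipschitz (hP : IsSmoothSaddleProblem X Y f L μ r) (hr : 0 < r)
    (hγ : 0 ≤ γ) (m : Fin M) (v : V d) {z w : V d} (hz : z ∈ feasible X Y)
    (hw : w ∈ feasible X Y) :
    ‖subOp γ (f m) v z - subOp γ (f m) v w‖ ≤ (1 + γ * L) * ‖z - w‖ := by
  have e : subOp γ (f m) v z - subOp γ (f m) v w =
      γ • (spOp (f m) z - spOp (f m) w) + (z - w) := by
    unfold subOp; module
  rw [e]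
  refine (norm_add_le _ _).trans ?_
  rw [norm_smul, Real.norm_of_nonneg hγ]
  have := mul_le_mul_of_nonneg_left (hP.lipschitz m z (mem_thickening_feasible hr hz) w
    (mem_thickening_feasible hr hw)) hγ
  linarith

theorem differentiableAt_subObj {φ : V d → ℝ} {v u : V d} (hφ : DifferentiableAt ℝ φ u) :
    DifferentiableAt ℝ (subObj γ φ v) u :=
  (hasGradientAt_subObj hφ).differentiableAt

/-- A solution of the local subproblem solves the variational inequality of its operator. -/
theorem IsSmoothSaddleProblem.inner_subOp_nonneg (hP : IsSmoothSaddleProblem X Y f L μ r)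
    (m : Fin M) {v u w : V d} (h : IsSolution X Y (subObj γ (f m) v) u)
    (hw : w ∈ feasible X Y) : 0 ≤ inner ℝ (subOp γ (f m) v u) (w - u) := by
  have hd := hP.differentiableAt m h.1
  rw [← spOp_subObj hd]
  exact h.inner_nonneg hP.convexX hP.convexY (differentiableAt_subObj hd) hw

theorem IsSmoothSaddleProblem.exists_isSolution_subObj (hP : IsSmoothSaddleProblem X Y f L μ r)
    (hr : 0 < r) (hL : 0 ≤ L) (hγ : 0 ≤ γ) (m : Fin M) (v : V d) :
    ∃ u, IsSolution X Y (subObj γ (f m) v) u := by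
  obtain ⟨p, hp, hvi⟩ := exists_inner_nonneg hP.isCompact hP.convex hP.nonempty
    (A := subOp γ (f m) v) (l := 1 + γ * L) (by nlinarith [mul_nonneg hγ hL])
    (fun z hz w hw => hP.subOp_stronglyMonotone hγ m v hz hw)
    (fun z hz w hw => hP.subOp_lipschitz hr hγ m v hz hw)
  refine ⟨p, isSolution_of_inner_nonneg hP.convexX hP.convexY hp
    (fun w hw => differentiableAt_subObj (hP.differentiableAt m hw)) ?_ ?_⟩
  · intro z hz w hw
    rw [spOp_subObj (hP.differentiableAt m hz), spOp_subObj (hP.differentiableAt m hw)]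
    exact (sq_nonneg _).trans (hP.subOp_stronglyMonotone hγ m v hz hw)
  · intro w hw
    rw [spOp_subObj (hP.differentiableAt m hp)]
    exact hvi w hw

theorem IsSmoothSaddleProblem.extragradient_mem (hP : IsSmoothSaddleProblem X Y f L μ r)
    (τ : ℝ) (m : Fin M) {z : V d} (hz : z ∈ feasible X Y) (v : V d) (n : ℕ) :
    extragradient X Y γ τ (f m) z v n ∈ feasible X Y := by
  cases n with
  | zero => exact hz
  | succ n => exact proj_mem hP.isCompact hP.nonempty _

theorem IsSmoothSaddleProblem.norm_sq_extragradient_sub_le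
    (hP : IsSmoothSaddleProblem X Y f L μ r) (hr : 0 < r) (hL : 0 ≤ L) (hγ : 0 ≤ γ) (m : Fin M)
    {z v p : V d} (hz : z ∈ feasible X Y) (hp : IsSolution X Y (subObj γ (f m) v) p) (n : ℕ) :
    ‖extragradient X Y γ (1 / (4 * (1 + γ * L))) (f m) z v n - p‖ ^ 2 ≤
      (1 - 1 / (4 * (1 + γ * L))) ^ n * ‖z - p‖ ^ 2 := by
  have hl : 1 ≤ 1 + γ * L := by nlinarith [mul_nonneg hγ hL]
  have hτ : 0 ≤ 1 - 1 / (4 * (1 + γ * L)) := by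
    rw [sub_nonneg, div_le_one (by linarith)]; linarith
  induction n with
  | zero => simp [extragradient]
  | succ n ih =>
    have hu := hP.extragradient_mem (γ := γ) (1 / (4 * (1 + γ * L))) m hz v n
    have h := norm_sq_extragradient_step_le hl
      (fun z hz w hw => hP.subOp_stronglyMonotone hγ m v hz hw)
      (fun z hz w hw => hP.subOp_lipschitz hr hγ m v hz hw) hp.1
      (fun w hw => hP.inner_subOp_nonneg m hp hw) hu (proj_mem hP.isCompact hP.nonempty _)
      (inner_sub_proj_le hP.isCompact hP.convex _ (proj_mem hP.isCompact hP.nonempty _))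
      (inner_sub_proj_le hP.isCompact hP.convex _ hp.1)
    refine h.trans ?_
    calc _ ≤ _ := mul_le_mul_of_nonneg_left ih hτ
      _ = _ := by rw [pow_succ' (1 - 1 / (4 * (1 + γ * L))) n, mul_assoc]

/-- Linear convergence of Extragradient on the local subproblems. -/
theorem IsSmoothSaddleProblem.isApproxSolution_extragradient
    (hP : IsSmoothSaddleProblem X Y f L μ r) (hr : 0 < r) (hL : 0 ≤ L) (hγ : 0 ≤ γ) (m : Fin M)
    {z : V d} (v : V d) (hz : z ∈ feasible X Y) {e : ℝ} (he : 0 < e) {n : ℕ}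
    (hn : 4 * (1 + γ * L) * Real.log (1 / e) ≤ n) :
    IsApproxSolution X Y γ e (f m) z v
      (extragradient X Y γ (1 / (4 * (1 + γ * L))) (f m) z v n) := by
  refine ⟨hP.extragradient_mem _ m hz v n, ?_⟩
  obtain ⟨p, hp⟩ := hP.exists_isSolution_subObj hr hL hγ m v
  refine ⟨p, hp, (hP.norm_sq_extragradient_sub_le hr hL hγ m hz hp n).trans ?_⟩
  gcongr
  have hl : 1 ≤ 1 + γ * L := by nlinarith [mul_nonneg hγ hL]
  have hτ : 0 ≤ 1 - 1 / (4 * (1 + γ * L)) := by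
    rw [sub_nonneg, div_le_one (by linarith)]; linarith
  calc (1 - 1 / (4 * (1 + γ * L))) ^ n ≤ Real.exp (-(1 / (4 * (1 + γ * L)))) ^ n := by
        gcongr
        linarith [Real.add_one_le_exp (-(1 / (4 * (1 + γ * L))))]
    _ = Real.exp (n * -(1 / (4 * (1 + γ * L)))) := (Real.exp_nat_mul _ _).symm
    _ ≤ Real.exp (Real.log e) := by
        gcongr
        rw [one_div, Real.log_inv] at hn
        rw [mul_neg, neg_le, mul_one_div, le_div_iff₀ (by linarith)]
        linarith
    _ = e := Real.exp_log he

end Subproblem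

end Extragradient

/-! ### Lipschitz constant of the deviation `F - F_m` -/

section Similarity

variable {d M : ℕ} {X Y : Set (E d)}

theorem hasGradientAt_avgFun {f : Fin M → V d → ℝ} {z : V d}
    (h : ∀ m, DifferentiableAt ℝ (f m) z) :
    HasGradientAt (avgFun f) ((1 / (M : ℝ)) • ∑ m, gradient (f m) z) z := by
  rw [hasGradientAt_iff_hasFDerivAt, map_smul, map_sum]
  exact (HasFDerivAt.fun_sum fun m _ => (h m).hasGradientAt.hasFDerivAt).const_mul _

theorem spOp_avgFun {f : Fin M → V d → ℝ} {z : V d} (h : ∀ m, DifferentiableAt ℝ (f m) z) :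
    spOp (avgFun f) z = avgOp f z := by
  unfold spOp avgOp
  rw [(hasGradientAt_avgFun h).gradient]
  let J : V d →ₗ[ℝ] V d :=
    { toFun := fun g => pair g.fst (-g.snd)
      map_add' := fun a b => WithLp.ofLp_injective 2
        (Prod.ext rfl (neg_add a.snd b.snd))
      map_smul' := fun c a => WithLp.ofLp_injective 2
        (Prod.ext rfl (smul_neg c a.snd).symm) }
  change J _ = (1 / (M : ℝ)) • ∑ m, J (gradient (f m) z)
  rw [map_smul, map_sum]

/-- Flipping the sign of the `y`-part is an isometry, so the operator deviation can be estimated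
through gradients, whose derivative is a symmetric Hessian. -/
theorem norm_spOp_sub (φ ψ : V d → ℝ) (z w : V d) :
    ‖(spOp ψ z - spOp φ z) - (spOp ψ w - spOp φ w)‖ =
      ‖(gradient φ z - gradient ψ z) - (gradient φ w - gradient ψ w)‖ := by
  set g := (gradient φ z - gradient ψ z) - (gradient φ w - gradient ψ w) with hg
  have e : (spOp ψ z - spOp φ z) - (spOp ψ w - spOp φ w) = pair (-g.fst) g.snd := by
    refine WithLp.ofLp_injective 2 (Prod.ext ?_ ?_)
    · change ((gradient ψ z).fst - (gradient φ z).fst) - ((gradient ψ w).fst - (gradient φ w).fst) =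
        -(((gradient φ z).fst - (gradient ψ z).fst) - ((gradient φ w).fst - (gradient ψ w).fst))
      abel
    · change (-(gradient ψ z).snd - -(gradient φ z).snd) -
        (-(gradient ψ w).snd - -(gradient φ w).snd) =
        (((gradient φ z).snd - (gradient ψ z).snd) - ((gradient φ w).snd - (gradient ψ w).snd))
      abel
  rw [e, ← sq_eq_sq₀ (norm_nonneg _) (norm_nonneg _), WithLp.prod_norm_sq_eq_of_L2,
    WithLp.prod_norm_sq_eq_of_L2 g]
  change ‖-g.fst‖ ^ 2 + ‖g.snd‖ ^ 2 = _
  rw [norm_neg]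

/-- The Hessian is symmetric. -/
theorem inner_hess_comm {φ : V d → ℝ} {z : V d} (h : ∀ᶠ w in nhds z, DifferentiableAt ℝ φ w)
    (h2 : DifferentiableAt ℝ (gradient φ) z) (v w : V d) :
    inner ℝ (hess φ z v) w = inner ℝ (hess φ z w) v := by
  let D : V d →L[ℝ] (V d →L[ℝ] ℝ) :=
    (InnerProductSpace.toDual ℝ (V d)).toContinuousLinearEquiv.toContinuousLinearMap
  have h1 : ∀ᶠ y in nhds z, HasFDerivAt φ (D (gradient φ y)) y := by
    filter_upwards [h] with y hy
    exact hy.hasGradientAt.hasFDerivAt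
  have h3 : HasFDerivAt (fun y => D (gradient φ y)) (D.comp (hess φ z)) z :=
    D.hasFDerivAt.comp z h2.hasFDerivAt
  exact second_derivative_symmetric_of_eventually h1 h3 v w

/-- By symmetry the missing `yx` block is the adjoint of the `xy` block, so all four blocks are
bounded by `δ`. Then `2 δ² (a + b)² ≤ 4 δ² (a² + b²)` gives the factor `2`. -/
theorem norm_le_of_blocks {P : V d →L[ℝ] V d} {δ : ℝ}
    (hsymm : ∀ v w, inner ℝ (P v) w = inner ℝ (P w) v)
    (hxx : ‖(WithLp.fstL 2 ℝ (E d) (E d)).comp (P.comp inlL)‖ ≤ δ)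
    (hxy : ‖(WithLp.fstL 2 ℝ (E d) (E d)).comp (P.comp inrL)‖ ≤ δ)
    (hyy : ‖(WithLp.sndL 2 ℝ (E d) (E d)).comp (P.comp inrL)‖ ≤ δ) : ‖P‖ ≤ 2 * δ := by
  have hδ : 0 ≤ δ := (norm_nonneg _).trans hxx
  refine P.opNorm_le_bound (by positivity) fun v => ?_
  have exx : ∀ x, ‖(P (inlL x)).fst‖ ≤ δ * ‖x‖ := fun x =>
    ((WithLp.fstL 2 ℝ (E d) (E d)).comp (P.comp inlL)).le_of_opNorm_le hxx x
  have exy : ∀ x, ‖(P (inrL x)).fst‖ ≤ δ * ‖x‖ := fun x =>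
    ((WithLp.fstL 2 ℝ (E d) (E d)).comp (P.comp inrL)).le_of_opNorm_le hxy x
  have eyy : ∀ x, ‖(P (inrL x)).snd‖ ≤ δ * ‖x‖ := fun x =>
    ((WithLp.sndL 2 ℝ (E d) (E d)).comp (P.comp inrL)).le_of_opNorm_le hyy x
  have eyx : ∀ x, ‖(P (inlL x)).snd‖ ≤ δ * ‖x‖ := by
    intro x
    set y := (P (inlL x)).snd with hy
    have h1 := hsymm (inlL x) (inrL y)
    rw [inner_pair_fst_snd, inner_pair_fst_snd (P (inrL y))] at h1
    have e1 : (inrL y : V d).fst = 0 := rfl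
    have e2 : (inrL y : V d).snd = y := rfl
    have e3 : (inlL x : V d).fst = x := rfl
    have e4 : (inlL x : V d).snd = 0 := rfl
    rw [e1, e2, e3, e4, inner_zero_right, inner_zero_right, zero_add, add_zero, ← hy,
      real_inner_self_eq_norm_sq] at h1
    have h2 := (real_inner_le_norm (P (inrL y)).fst x).trans
      (mul_le_mul_of_nonneg_right (exy y) (norm_nonneg x))
    rw [← h1] at h2
    by_contra! h3
    have h4 : 0 < ‖y‖ := (mul_nonneg hδ (norm_nonneg x)).trans_lt h3
    nlinarith
  have hv : v = inlL v.fst + inrL v.snd := by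
    refine WithLp.ofLp_injective 2 (Prod.ext ?_ ?_)
    · exact (add_zero v.fst).symm
    · exact (zero_add v.snd).symm
  have h1 : ‖(P v).fst‖ ≤ δ * ‖v.fst‖ + δ * ‖v.snd‖ := by
    have : (P v).fst = (P (inlL v.fst)).fst + (P (inrL v.snd)).fst := by
      nth_rewrite 1 [hv]; rw [map_add]; rfl
    rw [this]
    exact (norm_add_le _ _).trans (add_le_add (exx _) (exy _))
  have h2 : ‖(P v).snd‖ ≤ δ * ‖v.fst‖ + δ * ‖v.snd‖ := by
    have : (P v).snd = (P (inlL v.fst)).snd + (P (inrL v.snd)).snd := by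
      nth_rewrite 1 [hv]; rw [map_add]; rfl
    rw [this]
    exact (norm_add_le _ _).trans (add_le_add (eyx _) (eyy _))
  refine le_of_sq_le_sq ?_ (by positivity)
  rw [WithLp.prod_norm_sq_eq_of_L2, mul_pow, WithLp.prod_norm_sq_eq_of_L2 v]
  have h3 := pow_le_pow_left₀ (norm_nonneg _) h1 2
  have h4 := pow_le_pow_left₀ (norm_nonneg _) h2 2
  nlinarith [mul_nonneg (sq_nonneg δ) (sq_nonneg (‖v.fst‖ - ‖v.snd‖))]

theorem IsSmoothSaddleProblem.eventually_differentiableAt {f : Fin M → V d → ℝ} {L μ r : ℝ}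
    (hP : IsSmoothSaddleProblem X Y f L μ r) {z : V d} (hz : z ∈ feasible X Y) :
    ∀ᶠ w in nhds z, ∀ m, DifferentiableAt ℝ (f m) w := by
  rw [Filter.eventually_all]
  intro m
  obtain ⟨U, hU, hZU, h1, -⟩ := hP.twiceDiff m
  filter_upwards [hU.mem_nhds (hZU hz)] with w hw
  exact h1.differentiableAt (hU.mem_nhds hw)

theorem IsSmoothSaddleProblem.differentiableAt_gradient {f : Fin M → V d → ℝ} {L μ r : ℝ}
    (hP : IsSmoothSaddleProblem X Y f L μ r) (m : Fin M) {z : V d} (hz : z ∈ feasible X Y) :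
    DifferentiableAt ℝ (gradient (f m)) z := by
  obtain ⟨U, hU, hZU, -, h1⟩ := hP.twiceDiff m
  exact h1.differentiableAt (hU.mem_nhds (hZU hz))

theorem IsSmoothSaddleProblem.differentiableAt_gradient_avgFun {f : Fin M → V d → ℝ} {L μ r : ℝ}
    (hP : IsSmoothSaddleProblem X Y f L μ r) {z : V d} (hz : z ∈ feasible X Y) :
    DifferentiableAt ℝ (gradient (avgFun f)) z := by
  have h : gradient (avgFun f) =ᶠ[nhds z] fun w => (1 / (M : ℝ)) • ∑ m, gradient (f m) w := by
    filter_upwards [hP.eventually_differentiableAt hz] with w hw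
    exact (hasGradientAt_avgFun hw).gradient
  refine DifferentiableAt.congr_of_eventuallyEq ?_ h
  exact (DifferentiableAt.fun_sum fun m _ => hP.differentiableAt_gradient m hz).const_smul
    (1 / (M : ℝ))

/-- For `δ`-related functions the operator of a local deviation is `2δ`-Lipschitz. -/
theorem IsSmoothSaddleProblem.norm_deviation_sub_le {f : Fin M → V d → ℝ} {L μ r δ : ℝ}
    (hP : IsSmoothSaddleProblem X Y f L μ r) (hR : IsRelated X Y f δ) (m : Fin M) {z w : V d}
    (hz : z ∈ feasible X Y) (hw : w ∈ feasible X Y) :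
    ‖(avgOp f z - spOp (f m) z) - (avgOp f w - spOp (f m) w)‖ ≤ 2 * δ * ‖z - w‖ := by
  rw [← spOp_avgFun (fun m => hP.differentiableAt m hz),
    ← spOp_avgFun (fun m => hP.differentiableAt m hw), norm_spOp_sub]
  refine hP.convex.norm_image_sub_le_of_norm_hasFDerivWithin_le
    (f := fun u => gradient (f m) u - gradient (avgFun f) u)
    (f' := fun u => hess (f m) u - hess (avgFun f) u) (fun u hu => ?_) (fun u hu => ?_) hw hz
  · exact ((hP.differentiableAt_gradient m hu).hasFDerivAt.sub
      (hP.differentiableAt_gradient_avgFun hu).hasFDerivAt).hasFDerivWithinAt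
  · obtain ⟨h1, h2, h3⟩ := hR m u hu
    refine norm_le_of_blocks (fun v w => ?_) ?_ ?_ ?_
    · have hev := hP.eventually_differentiableAt hu
      have s1 := inner_hess_comm (hev.mono fun y hy => hy m) (hP.differentiableAt_gradient m hu) v w
      have s2 := inner_hess_comm (hev.mono fun y hy => (hasGradientAt_avgFun hy).differentiableAt)
        (hP.differentiableAt_gradient_avgFun hu) v w
      simp only [sub_apply, inner_sub_left, s1, s2]
    · rw [ContinuousLinearMap.sub_comp, ContinuousLinearMap.comp_sub]; exact h1
    · rw [ContinuousLinearMap.sub_comp, ContinuousLinearMap.comp_sub]; exact h2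
    · rw [ContinuousLinearMap.sub_comp, ContinuousLinearMap.comp_sub]; exact h3

end Similarity

/-! ### One step of the perturbed sliding scheme -/

section Descent

theorem norm_add_sq_le_young {F : Type*} [SeminormedAddCommGroup F] (a b : F) {t : ℝ}
    (ht : 0 < t) : ‖a + b‖ ^ 2 ≤ (1 + t) * ‖a‖ ^ 2 + (1 + 1 / t) * ‖b‖ ^ 2 := by
  have h1 := pow_le_pow_left₀ (norm_nonneg _) (norm_add_le a b) 2
  have h2 : (1 + t) * ‖a‖ ^ 2 + (1 + 1 / t) * ‖b‖ ^ 2 - (‖a‖ + ‖b‖) ^ 2 =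
      (t * ‖a‖ - ‖b‖) ^ 2 / t := by field_simp; ring
  have h3 : 0 ≤ (t * ‖a‖ - ‖b‖) ^ 2 / t := by positivity
  linarith

/-- One step of the sliding scheme with perturbed operators: `g` is the deviation of the local
operator, `uh` the exact and `ut` the approximate solution of the subproblem, `e₁` and `e₂` are the
errors of the averaged operators. -/
theorem norm_sq_sliding_step_le {F : Type*} [NormedAddCommGroup F] [InnerProductSpace ℝ F]
    {z zs uh ut gz gh gt Fh e₁ e₂ : F} {γ μ δ e lam : ℝ} (hγ : 0 < γ) (hμ : 0 < μ)
    (hγμ : γ * μ ≤ 1 / 12) (hγδ : γ * δ ≤ 1 / 7) (he : e * (8 + 4 * (γ * μ)) ≤ γ * μ)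
    (hR : inner ℝ (uh - z + γ • (gz - gh + e₁) + γ • Fh) (uh - zs) ≤ 0)
    (hF : μ * ‖uh - zs‖ ^ 2 ≤ inner ℝ Fh (uh - zs))
    (hg₁ : ‖gz - gh‖ ≤ 2 * δ * ‖z - uh‖) (hg₂ : ‖gh - gt‖ ≤ 2 * δ * ‖uh - ut‖)
    (hu : ‖ut - uh‖ ^ 2 ≤ e * ‖z - uh‖ ^ 2) (h₁ : ‖e₁‖ ≤ lam) (h₂ : ‖e₂‖ ≤ lam) :
    ‖ut + γ • (gz + e₁ - gt - e₂) - zs‖ ^ 2 ≤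
      (1 - γ * μ / 2) * ‖z - zs‖ ^ 2 + 7 * (γ ^ 2 + γ / μ) * lam ^ 2 := by
  set x := γ * μ with hx
  clear_value x
  have hx0 : 0 < x := hx ▸ mul_pos hγ hμ
  set Q := ‖z - uh‖ ^ 2 with hQ
  have hQ0 : 0 ≤ Q := sq_nonneg _
  -- The point reached if the subproblem were solved exactly and the second averaged operator had no
  -- error.
  set zo := uh + γ • (gz - gh + e₁) with hzo
  have hA : ‖zo - zs‖ ^ 2 ≤ ‖z - zs‖ ^ 2 - 2 * x * ‖uh - zs‖ ^ 2 - Q + ‖zo - uh‖ ^ 2 := by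
    have e1 : ‖zo - zs‖ ^ 2 = ‖z - zs‖ ^ 2 + 2 * inner ℝ (zo - z) (uh - zs) + ‖zo - uh‖ ^ 2 -
        ‖z - uh‖ ^ 2 := by
      simp only [← real_inner_self_eq_norm_sq, inner_sub_left, inner_sub_right,
        real_inner_comm zs zo, real_inner_comm zs z,
        real_inner_comm uh zo, real_inner_comm uh z]
      ring
    have e2 : uh - z + γ • (gz - gh + e₁) + γ • Fh = (zo - z) + γ • Fh := by rw [hzo]; abel
    rw [e2, inner_add_left, real_inner_smul_left] at hR
    have h1 := mul_le_mul_of_nonneg_left hF hγ.le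
    rw [e1, hx]
    linarith
  -- Here `γ · 2δ ≤ 2 / 7`, and Young's inequality with `t = 1 / 2` gives `3/2 · (2/7)² = 6/49`.
  have hB : ‖zo - uh‖ ^ 2 ≤ 6 / 49 * Q + 3 * γ ^ 2 * lam ^ 2 := by
    have e1 : zo - uh = γ • (gz - gh) + γ • e₁ := by rw [hzo]; module
    rw [e1]
    refine (norm_add_sq_le_young _ _ (by norm_num : (0 : ℝ) < 1 / 2)).trans ?_
    rw [norm_smul, norm_smul, Real.norm_of_nonneg hγ.le]
    have h1 : γ * ‖gz - gh‖ ≤ 2 / 7 * ‖z - uh‖ := by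
      have := mul_le_mul_of_nonneg_left hg₁ hγ.le
      nlinarith [norm_nonneg (z - uh)]
    have h2 := pow_le_pow_left₀ (by positivity) h1 2
    have h3 : (γ * ‖e₁‖) ^ 2 ≤ (γ * lam) ^ 2 := by gcongr
    rw [mul_pow (2 / 7 : ℝ), ← hQ] at h2
    linarith
  have hC : ‖z - zs‖ ^ 2 ≤ 2 * Q + 2 * ‖uh - zs‖ ^ 2 := by
    have h1 := norm_add_sq_le_young (z - uh) (uh - zs) one_pos
    rw [sub_add_sub_cancel] at h1
    linarith
  -- Moving half of the strong monotonicity term from `uh` to `z` costs `2 x Q ≤ Q / 6`. A definite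
  -- negative multiple of `Q` survives, to pay for the inexact solution: `-1 + 6/49 + 1/6 =
  -- -209/294`.
  have hD : ‖zo - zs‖ ^ 2 ≤ (1 - x) * ‖z - zs‖ ^ 2 - 209 / 294 * Q + 3 * γ ^ 2 * lam ^ 2 := by
    have h1 := mul_le_mul_of_nonneg_left hC hx0.le
    have h2 := mul_le_mul_of_nonneg_right hγμ hQ0
    linarith
  have hE : ‖ut + γ • (gz + e₁ - gt - e₂) - zo‖ ^ 2 ≤
      243 / 98 * (e * Q) + 3 * γ ^ 2 * lam ^ 2 := by
    have e1 : ut + γ • (gz + e₁ - gt - e₂) - zo = ((ut - uh) + γ • (gh - gt)) + (-(γ • e₂)) := by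
      rw [hzo]; module
    rw [e1]
    refine (norm_add_sq_le_young _ _ (by norm_num : (0 : ℝ) < 1 / 2)).trans ?_
    rw [norm_neg, norm_smul, Real.norm_of_nonneg hγ.le]
    have h1 : ‖(ut - uh) + γ • (gh - gt)‖ ≤ 9 / 7 * ‖ut - uh‖ := by
      refine (norm_add_le _ _).trans ?_
      rw [norm_smul, Real.norm_of_nonneg hγ.le]
      have := mul_le_mul_of_nonneg_left hg₂ hγ.le
      rw [norm_sub_rev uh ut] at this
      nlinarith [norm_nonneg (ut - uh)]
    have h2 := pow_le_pow_left₀ (by positivity) h1 2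
    have h3 : (γ * ‖e₂‖) ^ 2 ≤ (γ * lam) ^ 2 := by gcongr
    rw [mul_pow (9 / 7 : ℝ)] at h2
    linarith
  -- The parameter `x / 2` costs half of the contraction and weights the inexactness by `(x + 2) /
  -- x`. The hypothesis `he` makes that weight times `e` at most `1 / 4`, and `243/392 < 209/294`
  -- lets the surplus absorb it.
  have hY := norm_add_sq_le_young (zo - zs) (ut + γ • (gz + e₁ - gt - e₂) - zo)
    (by positivity : 0 < x / 2)
  rw [show zo - zs + (ut + γ • (gz + e₁ - gt - e₂) - zo) =
    ut + γ • (gz + e₁ - gt - e₂) - zs by abel] at hY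
  have hinv : 1 + 1 / (x / 2) = (x + 2) / x := by field_simp
  have h1 : (x + 2) / x * e ≤ 1 / 4 := by
    rw [div_mul_eq_mul_div, div_le_iff₀ hx0]; linarith
  have h2 : (1 + 1 / (x / 2)) * ‖ut + γ • (gz + e₁ - gt - e₂) - zo‖ ^ 2 ≤
      243 / 392 * Q + (3 * γ ^ 2 + 6 * (γ / μ)) * lam ^ 2 := by
    calc _ ≤ (1 + 1 / (x / 2)) * (243 / 98 * (e * Q) + 3 * γ ^ 2 * lam ^ 2) := by gcongr
      _ = 243 / 98 * ((x + 2) / x * e * Q) + (1 + 1 / (x / 2)) * (3 * γ ^ 2 * lam ^ 2) := by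
        rw [hinv]; ring
      _ ≤ 243 / 98 * (1 / 4 * Q) + (1 + 1 / (x / 2)) * (3 * γ ^ 2 * lam ^ 2) := by gcongr
      _ = _ := by rw [hx]; field_simp; ring
  have h3 := mul_le_mul_of_nonneg_left hD (by linarith : 0 ≤ 1 + x / 2)
  have h4 : (1 + x / 2) * ((1 - x) * ‖z - zs‖ ^ 2) ≤ (1 - x / 2) * ‖z - zs‖ ^ 2 := by
    rw [← mul_assoc]
    exact mul_le_mul_of_nonneg_right (by linarith [sq_nonneg x]) (sq_nonneg _)
  have h5 : 0 ≤ x * Q := by positivity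
  have h6 : 0 ≤ γ ^ 2 * lam ^ 2 := by positivity
  have h7 : x * (γ ^ 2 * lam ^ 2) ≤ 1 / 12 * (γ ^ 2 * lam ^ 2) := by gcongr
  have h8 : 0 ≤ γ / μ * lam ^ 2 := by positivity
  clear_value Q zo
  linarith

/-- Adds the spreading error to the sliding step, by Young's inequality with parameter `x / 4`. `N`
and `T` are squared distances at the active node before and after its step, `Q` is the common bound
for all nodes, `U` is the squared spreading error and `V` the new squared distance. -/
theorem descent_with_perturbation {x N Q T U V R E : ℝ} (hx0 : 0 < x) (hx1 : x ≤ 1 / 12)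
    (hN : 0 ≤ N) (hNQ : N ≤ Q) (hE : 0 ≤ E) (hT : T ≤ (1 - x / 2) * N + 7 * E)
    (hV : V ≤ (1 + x / 4) * T + (1 + 4 / x) * U) (hU : U ≤ R) :
    V ≤ (1 - x / 4) * Q + (14 * E + (1 + 4 / x) * R) := by
  have h1 : (1 + 4 / x) * U ≤ (1 + 4 / x) * R := by gcongr
  have h2 := mul_le_mul_of_nonneg_left hT (by linarith : 0 ≤ 1 + x / 4)
  have h3 : (1 + x / 4) * ((1 - x / 2) * N) ≤ (1 - x / 4) * Q := by
    rw [← mul_assoc]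
    exact mul_le_mul (by nlinarith) hNQ hN (by linarith)
  have h4 : x * E ≤ 1 / 12 * E := by gcongr
  linarith

end Descent

/-! ### One iteration of the distributed algorithm -/

section Run

variable {d M : ℕ} {X Y : Set (E d)} {f : Fin M → V d → ℝ} {L μ r δ : ℝ}
  {G : SimpleGraph (Fin M)} {W : Matrix (Fin M) (Fin M) ℝ}

theorem norm_avgPoint_sub_le (hM : 0 < M) {A : Fin M → V d} {c : V d} {T : ℝ}
    (h : ∀ i, ‖A i - c‖ ≤ T) : ‖avgPoint A - c‖ ≤ T := by
  have hMpos : (0 : ℝ) < M := by exact_mod_cast hM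
  have e : avgPoint A - c = (1 / (M : ℝ)) • ∑ i, (A i - c) := by
    rw [Finset.sum_sub_distrib, Finset.sum_const, Finset.card_univ, Fintype.card_fin, smul_sub,
      ← Nat.cast_smul_eq_nsmul ℝ, smul_smul, one_div_mul_cancel hMpos.ne', one_smul, avgPoint]
  rw [e, norm_smul, Real.norm_of_nonneg (by positivity), one_div, inv_mul_le_iff₀ hMpos]
  calc _ ≤ ∑ i, ‖A i - c‖ := norm_sum_le _ _
    _ ≤ ∑ _i : Fin M, T := Finset.sum_le_sum fun i _ => h i
    _ = M * T := by simp

theorem norm_avgPoint_sub_avgPoint_le (hM : 0 < M) {A A' : Fin M → V d} {T : ℝ}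
    (h : ∀ i, ‖A i - A' i‖ ≤ T) : ‖avgPoint A - avgPoint A'‖ ≤ T := by
  have e : avgPoint A - avgPoint A' = avgPoint (fun i => A i - A' i) := by
    simp only [avgPoint, Finset.sum_sub_distrib, smul_sub]
  rw [e]
  simpa using norm_avgPoint_sub_le hM (A := fun i => A i - A' i) (c := 0) (T := T) (by simpa using h)

/-- The error of the gossiped operators at points close to a common point `c`. -/
theorem IsSmoothSaddleProblem.norm_gossipOp_sub_le (hP : IsSmoothSaddleProblem X Y f L μ r)
    (hr : 0 < r) (hL : 0 ≤ L) (hW : IsGossipMatrix G W) (hG : G.Connected) (hM : 2 ≤ M) (H : ℕ)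
    {w : Fin M → V d} {c : V d} (hw : ∀ i, w i ∈ Metric.thickening r (feasible X Y))
    (hc : c ∈ feasible X Y) {T R : ℝ} (hT : ∀ i, ‖w i - c‖ ≤ T)
    (hR : ∀ i, ‖spOp (f i) (w i)‖ ≤ R) (m : Fin M) :
    ‖gossipOp f W (momentum (eigengap hW.isHermitian hM)) H w m - avgOp f c‖ ≤
      gossipRate (eigengap hW.isHermitian hM) H * (Real.sqrt M * R) + L * T := by
  have hR0 : 0 ≤ R := (norm_nonneg _).trans (hR m)
  have h1 := hW.norm_accGossip_sub_le hG hM (fun i => spOp (f i) (w i)) H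
    (R := Real.sqrt M * R) ?_ (by positivity) m
  · have h2 : ‖avgPoint (fun i => spOp (f i) (w i)) - avgPoint (fun i => spOp (f i) c)‖ ≤ L * T :=
      norm_avgPoint_sub_avgPoint_le (by omega) fun i =>
        (hP.lipschitz i _ (hw i) _ (mem_thickening_feasible hr hc)).trans
          (mul_le_mul_of_nonneg_left (hT i) hL)
    exact (norm_sub_le_norm_sub_add_norm_sub _ _ _).trans (add_le_add h1 h2)
  · rw [mul_pow, Real.sq_sqrt (Nat.cast_nonneg M)]
    calc _ ≤ ∑ _i : Fin M, R ^ 2 := Finset.sum_le_sum fun i _ =>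
          pow_le_pow_left₀ (norm_nonneg _) (hR i) 2
      _ = M * R ^ 2 := by simp

theorem IsSmoothSaddleProblem.norm_spOp_le (hP : IsSmoothSaddleProblem X Y f L μ r) (hr : 0 < r)
    (hL : 0 ≤ L) {zs w : V d} (hzs : zs ∈ feasible X Y)
    (hw : w ∈ Metric.thickening r (feasible X Y)) (m : Fin M) {B T : ℝ}
    (hB : ‖spOp (f m) zs‖ ≤ B) (hT : ‖w - zs‖ ≤ T) : ‖spOp (f m) w‖ ≤ L * T + B := by
  have h1 := (hP.lipschitz m w hw zs (mem_thickening_feasible hr hzs)).trans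
    (mul_le_mul_of_nonneg_left hT hL)
  have h2 := norm_add_le (spOp (f m) w - spOp (f m) zs) (spOp (f m) zs)
  rw [sub_add_cancel] at h2
  linarith

/-- One iteration of the distributed algorithm. -/
theorem IsSmoothSaddleProblem.iteration_le (hP : IsSmoothSaddleProblem X Y f L μ r)
    (hRel : IsRelated X Y f δ) (hr : 0 < r) (hL : 0 ≤ L) (hμ : 0 < μ)
    (hW : IsGossipMatrix G W) (hG : G.Connected) (hM : 2 ≤ M) {zs : V d}
    (hzs : IsSolution X Y (avgFun f) zs) {D B : ℝ} (hD : ∀ z ∈ feasible X Y, ‖z‖ ≤ D)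
    (hD' : ∀ z ∈ feasible X Y, ∀ w ∈ feasible X Y, ‖z - w‖ ≤ D)
    (hB : ∀ m, ‖spOp (f m) zs‖ ≤ B) {γ e : ℝ} (hγ : 0 < γ) (hγμ : γ * μ ≤ 1 / 12)
    (hγδ : γ * δ ≤ 1 / 7) (he : e * (8 + 4 * (γ * μ)) ≤ γ * μ) {H₀ H₁ : ℕ} {S lam Q : ℝ}
    (hS : gossipRate (eigengap hW.isHermitian hM) H₁ * (M * (3 * D)) ≤ S) (hSr : S < r)
    (hSD : S ≤ D)
    (hlam : gossipRate (eigengap hW.isHermitian hM) H₀ * (Real.sqrt M * (L * (2 * D) + B)) +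
      L * (2 * S) ≤ lam)
    (hlamD : 7 * (γ ^ 2 + γ / μ) * lam ^ 2 ≤ D ^ 2)
    {m : Fin M} {z : Fin M → V d} {u : V d} (hz : ∀ i, z i ∈ feasible X Y)
    (hzz : ∀ i j, ‖z i - z j‖ ≤ 2 * S) (hQ : ∀ i, ‖z i - zs‖ ^ 2 ≤ Q)
    (hu : IsApproxSolution X Y γ e (f m) (z m)
      (vPoint f W (momentum (eigengap hW.isHermitian hM)) γ H₀ m z) u)
    {z' : Fin M → V d}
    (hz' : ∀ i, z' i = proj (feasible X Y)
      (spread W (momentum (eigengap hW.isHermitian hM)) H₁ m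
        (zTilde f W (momentum (eigengap hW.isHermitian hM)) γ H₀ H₁ m z u) i)) :
    (∀ i, z' i ∈ feasible X Y) ∧ (∀ i j, ‖z' i - z' j‖ ≤ 2 * S) ∧
      ∀ i, ‖z' i - zs‖ ^ 2 ≤ (1 - γ * μ / 4) * Q +
        (14 * (γ ^ 2 + γ / μ) * lam ^ 2 + (1 + 4 / (γ * μ)) * S ^ 2) := by
  obtain ⟨huZ, uh, huh, hue⟩ := hu
  set ρ := eigengap hW.isHermitian hM with hρ
  set η := momentum ρ with hη
  have hzsZ := hzs.1
  have hD0 : 0 ≤ D := (norm_nonneg _).trans (hD zs hzsZ)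
  have hB0 : 0 ≤ B := (norm_nonneg _).trans (hB m)
  have hrate : ∀ a : V d, ‖a‖ ≤ 3 * D → ∀ i, ‖spread W η H₁ m a i - a‖ ≤ S := by
    intro a ha i
    refine (hW.norm_spread_sub_le hG hM m a H₁ i).trans (le_trans ?_ hS)
    have := gossipRate_nonneg ρ H₁
    gcongr
  have hS0 : 0 ≤ S := (norm_nonneg _).trans (hrate 0 (by simpa using hD0) m)
  have huS := hrate u ((hD u huZ).trans (by linarith))
  -- The spread copies of `u` are not projected and may leave the feasible set; `S < r` keeps them
  -- where the local operators are Lipschitz.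
  have huT : ∀ i, spread W η H₁ m u i ∈ Metric.thickening r (feasible X Y) := fun i =>
    Metric.mem_thickening_iff.2 ⟨u, huZ, by rw [dist_eq_norm]; exact (huS i).trans_lt hSr⟩
  have hg0 := gossipRate_nonneg ρ H₀
  set e₁ := gossipOp f W η H₀ z m - avgOp f (z m) with he₁
  set e₂ := gossipOp f W η H₀ (spread W η H₁ m u) m - avgOp f u with he₂
  have h₁ : ‖e₁‖ ≤ lam := by
    refine (hP.norm_gossipOp_sub_le hr hL hW hG hM H₀
      (fun i => mem_thickening_feasible hr (hz i)) (hz m) (fun i => hzz i m)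
      (fun i => hP.norm_spOp_le hr hL hzsZ (mem_thickening_feasible hr (hz i)) i (hB i)
        ((hD' _ (hz i) _ hzsZ).trans (by linarith : D ≤ 2 * D))) m).trans hlam
  have h₂ : ‖e₂‖ ≤ lam := by
    refine (hP.norm_gossipOp_sub_le hr hL hW hG hM H₀ huT huZ
      (fun i => (huS i).trans (by linarith : S ≤ 2 * S))
      (fun i => hP.norm_spOp_le hr hL hzsZ (huT i) i (hB i) ?_) m).trans hlam
    have h1 := norm_sub_le_norm_sub_add_norm_sub (spread W η H₁ m u i) u zs
    linarith [huS i, hD' u huZ zs hzsZ]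
  have hstep := norm_sq_sliding_step_le (z := z m) (zs := zs) (uh := uh) (ut := u)
    (gz := avgOp f (z m) - spOp (f m) (z m)) (gh := avgOp f uh - spOp (f m) uh)
    (gt := avgOp f u - spOp (f m) u) (Fh := avgOp f uh) (e₁ := e₁) (e₂ := e₂) hγ hμ hγμ hγδ he
    ?_ ?_ (hP.norm_deviation_sub_le hRel m (hz m) huh.1)
    (hP.norm_deviation_sub_le hRel m huh.1 huZ) hue h₁ h₂
  · have ezt : u + γ • (avgOp f (z m) - spOp (f m) (z m) + e₁ - (avgOp f u - spOp (f m) u) - e₂) =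
        zTilde f W η γ H₀ H₁ m z u := by
      rw [zTilde, he₁, he₂]; module
    rw [ezt] at hstep
    set zt := zTilde f W η γ H₀ H₁ m z u with hzt
    have hx0 : 0 < γ * μ := mul_pos hγ hμ
    -- The point `zt` may also be infeasible. Since the spreading error is proportional to the norm
    -- of the vector sent, the a priori bound `‖zt‖ ≤ 3 D` is needed; it is the origin of `3 * D` in
    -- `hS`.
    have hztD : ‖zt - zs‖ ≤ 2 * D := by
      refine le_of_sq_le_sq ?_ (by positivity)
      have h1 := pow_le_pow_left₀ (norm_nonneg _) (hD' _ (hz m) _ hzsZ) 2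
      nlinarith [sq_nonneg ‖z m - zs‖]
    have hzt3 : ‖zt‖ ≤ 3 * D := by
      have h1 := norm_add_le (zt - zs) zs
      rw [sub_add_cancel] at h1
      linarith [hD zs hzsZ]
    have hs := hrate zt hzt3
    refine ⟨fun i => ?_, fun i j => ?_, fun i => ?_⟩
    · rw [hz']; exact proj_mem hP.isCompact hP.nonempty _
    · rw [hz', hz']
      refine (norm_proj_sub_proj_le hP.isCompact hP.convex hP.nonempty _ _).trans ?_
      have h1 := norm_sub_le_norm_sub_add_norm_sub (spread W η H₁ m zt i) zt
        (spread W η H₁ m zt j)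
      rw [norm_sub_rev zt] at h1
      linarith [hs i, hs j]
    · rw [hz']
      have h1 := norm_proj_sub_le hP.isCompact hP.convex (spread W η H₁ m zt i) hzsZ
      have h2 := pow_le_pow_left₀ (norm_nonneg _) h1 2
      have h3 := norm_add_sq_le_young (zt - zs) (spread W η H₁ m zt i - zt)
        (by positivity : 0 < γ * μ / 4)
      rw [show zt - zs + (spread W η H₁ m zt i - zt) = spread W η H₁ m zt i - zs by abel] at h3
      have h4 := pow_le_pow_left₀ (norm_nonneg _) (hs i) 2
      have h5 : 1 + 1 / (γ * μ / 4) = 1 + 4 / (γ * μ) := by rw [one_div_div]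
      rw [h5] at h3
      have h6 := descent_with_perturbation hx0 hγμ (sq_nonneg ‖z m - zs‖) (hQ m)
        (by positivity : 0 ≤ (γ ^ 2 + γ / μ) * lam ^ 2) (hstep.trans_eq (by rw [mul_assoc]))
        (h2.trans h3) h4
      rwa [mul_assoc 14]
  -- Variational inequality of the subproblem tested at the global solution; in `subOp` the local
  -- operators recombine with the averages into `avgOp` and deviations.
  · have h := hP.inner_subOp_nonneg m huh hzsZ
    have e1 : uh - z m + γ • (avgOp f (z m) - spOp (f m) (z m) - (avgOp f uh - spOp (f m) uh) + e₁)
        + γ • avgOp f uh = subOp γ (f m) (vPoint f W η γ H₀ m z) uh := by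
      rw [subOp, vPoint, he₁]; module
    rw [e1, ← neg_sub zs uh, inner_neg_right]
    linarith
  · have hvi := hzs.inner_nonneg hP.convexX hP.convexY
      (hasGradientAt_avgFun fun m => hP.differentiableAt m hzsZ).differentiableAt huh.1
    rw [spOp_avgFun fun m => hP.differentiableAt m hzsZ] at hvi
    have h1 := hP.stronglyMonotone uh huh.1 zs hzsZ
    rw [inner_sub_left] at h1
    linarith

end Run

/-! ### Choice of the parameters -/

section Tuning

theorem two_le_exp_one : (2 : ℝ) ≤ Real.exp 1 := by
  linarith [Real.add_one_le_exp (1 : ℝ)]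

theorem one_le_logE {a : ℝ} (ha : 0 ≤ a) : 1 ≤ logE a := by
  unfold logE
  rw [Real.le_log_iff_exp_le (by positivity)]
  linarith

theorem exp_neg_mul_logE {a : ℝ} (ha : 0 ≤ a) (n : ℕ) :
    Real.exp (-(n * logE a)) = (Real.exp 1 + a)⁻¹ ^ n := by
  rw [Real.exp_neg, Real.exp_nat_mul, logE, Real.exp_log (by positivity), inv_pow]

theorem logE_le_mul {a b c : ℝ} (hb : 0 ≤ b) (hc : 0 ≤ c) (ha : 0 ≤ a)
    (h : Real.exp 1 + a ≤ (Real.exp 1 + b) * (Real.exp 1 + c)) :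
    logE a ≤ 2 * (logE b * logE c) := by
  have h1 : logE a ≤ logE b + logE c := by
    unfold logE
    rw [← Real.log_mul (by positivity) (by positivity)]
    exact Real.log_le_log (by positivity) h
  nlinarith [one_le_logE hb, one_le_logE hc]

/-- Separates `ε` from the problem parameters: `e + a/ε + b ≤ (e + a + b)(e + 1/ε)`, and a sum of
two numbers that are at least `1` is at most twice their product. -/
theorem logE_div_le {a b ε : ℝ} (ha : 0 ≤ a) (hb : 0 ≤ b) (hε : 0 < ε) :
    logE (a / ε + b) ≤ 2 * (logE (a + b) * logE (1 / ε)) := by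
  refine logE_le_mul (by positivity) (by positivity) (by positivity) ?_
  have h := two_le_exp_one
  have h1 : 0 ≤ 1 / ε := by positivity
  have h2 : a / ε = a * (1 / ε) := by ring
  rw [h2]
  nlinarith [mul_nonneg hb h1, mul_nonneg ha h1]

/-- The constant `60` against the decay rate `√ρ / 4` leaves the fifteenth power of the inverse
argument of the logarithm. -/
theorem gossipRate_ceil_le {ρ : ℝ} (h0 : 0 < ρ) (h1 : ρ ≤ 1) {a : ℝ} (ha : 0 ≤ a) :
    gossipRate ρ ⌈60 * (1 / Real.sqrt ρ) * logE a⌉₊ ≤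
      12 / Real.sqrt ρ * (Real.exp 1 + a)⁻¹ ^ 15 := by
  refine (gossipRate_le h0 h1 _).trans ?_
  rw [← exp_neg_mul_logE ha 15]
  have hs : 0 < Real.sqrt ρ := Real.sqrt_pos.2 h0
  gcongr
  have h2 := Nat.le_ceil (60 * (1 / Real.sqrt ρ) * logE a)
  have h3 := mul_le_mul_of_nonneg_left h2 hs.le
  have h4 : Real.sqrt ρ * (60 * (1 / Real.sqrt ρ) * logE a) = 60 * logE a := by field_simp
  push_cast
  nlinarith

theorem stepSize_pos {μ δ : ℝ} (hμ : 0 < μ) (hδ : 0 < δ) : 0 < stepSize μ δ :=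
  lt_min (by positivity) (by positivity)

theorem stepSize_mul_le {μ δ : ℝ} (hμ : 0 < μ) : stepSize μ δ * μ ≤ 1 / 12 := by
  calc _ ≤ 1 / (12 * μ) * μ := by gcongr; exact min_le_left _ _
    _ = _ := by field_simp

theorem stepSize_mul_le' {μ δ : ℝ} (hδ : 0 < δ) : stepSize μ δ * δ ≤ 1 / 7 := by
  calc _ ≤ 1 / (7 * δ) * δ := by gcongr; exact min_le_right _ _
    _ = _ := by field_simp

theorem one_div_stepSize_mul_le {μ δ : ℝ} (hμ : 0 < μ) (hδ : 0 < δ) :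
    1 / (stepSize μ δ * μ) ≤ 12 * (1 + δ / μ) := by
  have h0 : 0 < δ / μ := by positivity
  rw [div_le_iff₀ (mul_pos (stepSize_pos hμ hδ) hμ)]
  rcases min_choice (1 / (12 * μ)) (1 / (7 * δ)) with h | h
  · have e : stepSize μ δ * μ = 1 / 12 := by unfold stepSize; rw [h]; field_simp
    rw [e]; linarith
  · have e : δ / μ * (stepSize μ δ * μ) = 1 / 7 := by unfold stepSize; rw [h]; field_simp
    have h1 := mul_pos (stepSize_pos hμ hδ) hμ
    nlinarith

theorem innerAcc_pos {γ μ δ : ℝ} (hγ : 0 < γ) (hμ : 0 < μ) : 0 < innerAcc γ μ δ := by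
  unfold innerAcc; positivity

/-- Only the terms `2` and `4 / (γ μ)` in the denominator of `innerAcc` are needed; the other two
are nonnegative. -/
theorem innerAcc_mul_le {γ μ δ : ℝ} (hγ : 0 < γ) (hμ : 0 < μ) :
    innerAcc γ μ δ * (8 + 4 * (γ * μ)) ≤ γ * μ := by
  unfold innerAcc
  rw [one_div_mul_eq_div, div_le_iff₀ (by positivity)]
  have h1 : γ * μ * (4 / (γ * μ)) = 4 := by field_simp
  have h2 : 0 ≤ γ * μ * (12 * γ ^ 2 * δ ^ 2) := by positivity
  have h3 : 0 ≤ γ * μ * (8 * γ * δ ^ 2 / μ) := by positivity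
  calc 8 + 4 * (γ * μ) = 2 * (2 * (γ * μ) + γ * μ * (4 / (γ * μ))) := by rw [h1]; ring
    _ ≤ 2 * (2 * (γ * μ) + γ * μ * (4 / (γ * μ))) + 2 * (γ * μ * (12 * γ ^ 2 * δ ^ 2)) +
        2 * (γ * μ * (8 * γ * δ ^ 2 / μ)) := by linarith
    _ = _ := by ring

/-- `u` and `w` stand for the inverse arguments of the logarithms in `H₀` and `H₁`. Each
parameter-dependent factor is cancelled by one power of `u` or `w`, and the remaining powers, at
most those of `1 / 2`, beat the numerical constants. -/
theorem gossip_error_le_of_rates {M : ℕ} {γ μ L D B ρ ε r k₀ k₁ A₀ A₁ b u w : ℝ} (hM0 : (0 : ℝ) < M)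
    (hγ : 0 < γ) (hμ : 0 < μ) (hγμ : γ * μ ≤ 1 / 12) (hL : 0 ≤ L) (hD : 0 < D) (hB : 0 ≤ B)
    (hρ : 0 < ρ) (hρ1 : ρ ≤ 1) (hε : 0 < ε) (hεD : ε < D ^ 2) (hr : 0 < r) (hk₀ : 0 ≤ k₀)
    (hk₁ : 0 ≤ k₁) (hA₀ : A₀ = argH₀ M γ μ L D B ρ) (hA₁ : A₁ = argH₁ M γ μ L D ρ)
    (hA₀0 : 0 ≤ A₀) (hA₁0 : 0 ≤ A₁) (hb : b = D / (r * ρ)) (hb0 : 0 ≤ b)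
    (hu0 : 0 ≤ u) (hw0 : 0 ≤ w) (hu2 : u ≤ 1 / 2) (hw2 : w ≤ 1 / 2)
    (h₀ : k₀ ≤ 12 / Real.sqrt ρ * u ^ 15) (h₁ : k₁ ≤ 12 / Real.sqrt ρ * w ^ 15)
    (hau : A₀ / ε * u ≤ 1) (haw : A₁ / ε * w ≤ 1) (hbw : b * w ≤ 1)
    (hmw : M / (ρ * (γ * μ)) * w ≤ 1) (hMw : M / Real.sqrt ρ * w ≤ 1) (hMw' : M * w ≤ 1)
    {S lam : ℝ} (hS : S = k₁ * (M * (3 * D)))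
    (hlam : lam = k₀ * (Real.sqrt M * (L * (2 * D) + B)) + L * (2 * S)) :
    S < r ∧ S ≤ D ∧ 7 * (γ ^ 2 + γ / μ) * lam ^ 2 ≤ D ^ 2 ∧
      4 / (γ * μ) * (14 * (γ ^ 2 + γ / μ) * lam ^ 2 + (1 + 4 / (γ * μ)) * S ^ 2) ≤ ε / 2 := by
  have hx0 : 0 < γ * μ := mul_pos hγ hμ
  have hs : 0 < Real.sqrt ρ := Real.sqrt_pos.2 hρ
  have hsq : Real.sqrt ρ ^ 2 = ρ := Real.sq_sqrt hρ.le
  have hu29 : u ^ 29 ≤ (1 / 2) ^ 29 := by gcongr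
  have hw28 : w ^ 28 ≤ (1 / 2) ^ 28 := by gcongr
  have hw13 : w ^ 13 ≤ (1 / 2) ^ 13 := by gcongr
  have hw14 : w ^ 14 ≤ (1 / 2) ^ 14 := by gcongr
  have hS0 : 0 ≤ S := by rw [hS]; positivity
  have hk₀2 : ρ * k₀ ^ 2 ≤ 144 * u ^ 30 := by
    calc _ ≤ ρ * (12 / Real.sqrt ρ * u ^ 15) ^ 2 := by gcongr
      _ = _ := by rw [mul_pow, div_pow, hsq]; field_simp; norm_num; ring
  have hk₁2 : ρ * k₁ ^ 2 ≤ 144 * w ^ 30 := by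
    calc _ ≤ ρ * (12 / Real.sqrt ρ * w ^ 15) ^ 2 := by gcongr
      _ = _ := by rw [mul_pow, div_pow, hsq]; field_simp; norm_num; ring
  have hSle : S ≤ 36 * D * (M / Real.sqrt ρ * w) * w ^ 14 := by
    rw [hS]
    calc _ ≤ (12 / Real.sqrt ρ * w ^ 15) * (M * (3 * D)) := by gcongr
      _ = _ := by ring
  have hSD : S ≤ D := by
    calc S ≤ 36 * D * 1 * (1 / 2) ^ 14 := hSle.trans (by gcongr)
      _ ≤ D := by linarith
  have hSr : S < r := by
    have hDb : D = r * ρ * b := by rw [hb]; field_simp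
    calc S ≤ 36 * D * (M / Real.sqrt ρ * w) * w ^ 14 := hSle
      _ = 36 * r * ρ * (b * w) * (M / Real.sqrt ρ * w) * w ^ 13 := by
        nth_rewrite 1 [hDb]; ring
      _ ≤ 36 * r * 1 * 1 * 1 * (1 / 2) ^ 13 := by gcongr
      _ < r := by linarith
  have hlam2 : lam ^ 2 ≤ 8 * (k₀ ^ 2 * M * (L * D + B) ^ 2) + 8 * (L ^ 2 * S ^ 2) := by
    have hsM : Real.sqrt M ^ 2 = M := Real.sq_sqrt hM0.le
    have h1 : k₀ * (Real.sqrt M * (L * (2 * D) + B)) ≤ 2 * (k₀ * (Real.sqrt M * (L * D + B))) := by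
      have : 0 ≤ k₀ * (Real.sqrt M * B) := by positivity
      linarith
    have h2 : lam ≤ 2 * (k₀ * (Real.sqrt M * (L * D + B))) + 2 * (L * S) := by
      rw [hlam]; linarith
    have h3 : 0 ≤ lam := by rw [hlam]; positivity
    have h4 := pow_le_pow_left₀ h3 h2 2
    calc lam ^ 2 ≤ _ := h4
      _ ≤ 8 * (k₀ * (Real.sqrt M * (L * D + B))) ^ 2 + 8 * (L * S) ^ 2 := by
        linarith [sq_nonneg (k₀ * (Real.sqrt M * (L * D + B)) - L * S)]
      _ = _ := by rw [mul_pow, mul_pow, hsM]; ring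
  have hT₁ : (γ ^ 2 + γ / μ) / (γ * μ) * (k₀ ^ 2 * M * (L * D + B) ^ 2) ≤
      144 * ε * (1 / 2) ^ 29 := by
    calc _ = A₀ * (ρ * k₀ ^ 2) := by rw [hA₀]; unfold argH₀; field_simp
      _ ≤ A₀ * (144 * u ^ 30) := by gcongr
      _ = 144 * ε * (A₀ / ε * u) * u ^ 29 := by field_simp
      _ ≤ 144 * ε * 1 * (1 / 2) ^ 29 := by gcongr
      _ = _ := by ring
  have hT₂ : (γ ^ 2 + γ / μ) / (γ * μ) * (L ^ 2 * S ^ 2) ≤ 1296 * ε * (1 / 2) ^ 28 := by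
    calc _ = ((γ ^ 2 * L ^ 2 + γ * L ^ 2 / μ) * M * D ^ 2 / (γ * μ * ρ)) *
          (9 * M * (ρ * k₁ ^ 2)) := by rw [hS]; field_simp; ring
      _ ≤ A₁ * (9 * M * (144 * w ^ 30)) := by
        gcongr
        rw [hA₁]; unfold argH₁
        gcongr
        linarith
      _ = 1296 * ε * (A₁ / ε * w) * (M * w) * w ^ 28 := by field_simp; ring
      _ ≤ 1296 * ε * 1 * 1 * (1 / 2) ^ 28 := by gcongr
      _ = _ := by ring
  have hT₃ : 1 / (γ * μ) * ((1 + 4 / (γ * μ)) * S ^ 2) ≤ 6480 * ε * (1 / 2) ^ 28 := by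
    have h1 : 1 + 4 / (γ * μ) ≤ 5 / (γ * μ) := by
      rw [← sub_nonneg]
      have : 5 / (γ * μ) - (1 + 4 / (γ * μ)) = (1 - γ * μ) / (γ * μ) := by field_simp; ring
      rw [this]
      exact div_nonneg (by linarith) hx0.le
    calc _ ≤ 1 / (γ * μ) * ((5 / (γ * μ)) * S ^ 2) := by gcongr
      _ = (1 * M * D ^ 2 / (γ * μ * ρ)) * (45 * (M / (ρ * (γ * μ))) * ρ * (ρ * k₁ ^ 2)) := by
        rw [hS]; field_simp; ring
      _ ≤ A₁ * (45 * (M / (ρ * (γ * μ))) * 1 * (144 * w ^ 30)) := by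
        gcongr
        rw [hA₁]; unfold argH₁
        gcongr
        have : 0 ≤ γ ^ 2 * L ^ 2 + γ * L ^ 2 / μ := by positivity
        linarith
      _ = 6480 * ε * (A₁ / ε * w) * (M / (ρ * (γ * μ)) * w) * w ^ 28 := by field_simp; ring
      _ ≤ 6480 * ε * 1 * 1 * (1 / 2) ^ 28 := by gcongr
      _ = _ := by ring
  have hfin : 4 / (γ * μ) * (14 * (γ ^ 2 + γ / μ) * lam ^ 2 + (1 + 4 / (γ * μ)) * S ^ 2) ≤
      ε / 2 := by
    calc _ = 56 * ((γ ^ 2 + γ / μ) / (γ * μ) * lam ^ 2) +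
          4 * (1 / (γ * μ) * ((1 + 4 / (γ * μ)) * S ^ 2)) := by ring
      _ ≤ 56 * ((γ ^ 2 + γ / μ) / (γ * μ) *
          (8 * (k₀ ^ 2 * M * (L * D + B) ^ 2) + 8 * (L ^ 2 * S ^ 2))) +
          4 * (1 / (γ * μ) * ((1 + 4 / (γ * μ)) * S ^ 2)) := by gcongr
      _ = 448 * ((γ ^ 2 + γ / μ) / (γ * μ) * (k₀ ^ 2 * M * (L * D + B) ^ 2)) +
          448 * ((γ ^ 2 + γ / μ) / (γ * μ) * (L ^ 2 * S ^ 2)) +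
          4 * (1 / (γ * μ) * ((1 + 4 / (γ * μ)) * S ^ 2)) := by ring
      _ ≤ 448 * (144 * ε * (1 / 2) ^ 29) + 448 * (1296 * ε * (1 / 2) ^ 28) +
          4 * (6480 * ε * (1 / 2) ^ 28) := by gcongr
      _ ≤ ε / 2 := by linarith
  -- The bound on `lam` follows from the final estimate, as `4 / (γ μ) ≥ 1` and `ε / 2 ≤ D ^ 2`.
  refine ⟨hSr, hSD, ?_, hfin⟩
  have h1 : 1 ≤ 4 / (γ * μ) := by rw [one_le_div hx0]; linarith
  have h2 : 0 ≤ 14 * (γ ^ 2 + γ / μ) * lam ^ 2 := by positivity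
  have h3 : 0 ≤ (1 + 4 / (γ * μ)) * S ^ 2 := by positivity
  have h4 := mul_le_mul_of_nonneg_right h1 (add_nonneg h2 h3)
  linarith

/-- The gossip parameters make the accumulated communication error at most half of the target. -/
theorem gossip_error_le {M : ℕ} {γ μ L D B ρ ε r k₀ k₁ : ℝ} (hM : 0 < M) (hγ : 0 < γ)
    (hμ : 0 < μ) (hγμ : γ * μ ≤ 1 / 12) (hL : 0 ≤ L) (hD : 0 < D) (hB : 0 ≤ B) (hρ : 0 < ρ)
    (hρ1 : ρ ≤ 1) (hε : 0 < ε) (hεD : ε < D ^ 2) (hr : 0 < r) (hk₀ : 0 ≤ k₀) (hk₁ : 0 ≤ k₁)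
    (h₀ : k₀ ≤ 12 / Real.sqrt ρ * (Real.exp 1 + argH₀ M γ μ L D B ρ / ε)⁻¹ ^ 15)
    (h₁ : k₁ ≤ 12 / Real.sqrt ρ *
      (Real.exp 1 + (argH₁ M γ μ L D ρ / ε + D / (r * ρ)))⁻¹ ^ 15) {S lam : ℝ}
    (hS : S = k₁ * (M * (3 * D)))
    (hlam : lam = k₀ * (Real.sqrt M * (L * (2 * D) + B)) + L * (2 * S)) :
    S < r ∧ S ≤ D ∧ 7 * (γ ^ 2 + γ / μ) * lam ^ 2 ≤ D ^ 2 ∧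
      4 / (γ * μ) * (14 * (γ ^ 2 + γ / μ) * lam ^ 2 + (1 + 4 / (γ * μ)) * S ^ 2) ≤ ε / 2 := by
  have hM0 : (0 : ℝ) < M := by exact_mod_cast hM
  have hx0 : 0 < γ * μ := mul_pos hγ hμ
  have hs : 0 < Real.sqrt ρ := Real.sqrt_pos.2 hρ
  have hs1 : Real.sqrt ρ ≤ 1 := Real.sqrt_le_one.2 hρ1
  have hsq : Real.sqrt ρ ^ 2 = ρ := Real.sq_sqrt hρ.le
  have he := two_le_exp_one
  set A₀ := argH₀ M γ μ L D B ρ with hA₀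
  set A₁ := argH₁ M γ μ L D ρ with hA₁
  have hA₀0 : 0 ≤ A₀ := by rw [hA₀]; unfold argH₀; positivity
  have hA₁0 : 0 ≤ A₁ := by rw [hA₁]; unfold argH₁; positivity
  set b := D / (r * ρ) with hb
  have hb0 : 0 ≤ b := by positivity
  set u := (Real.exp 1 + A₀ / ε)⁻¹ with hu
  set w := (Real.exp 1 + (A₁ / ε + b))⁻¹ with hw
  have hu0 : 0 ≤ u := by positivity
  have hw0 : 0 ≤ w := by positivity
  have hu2 : u ≤ 1 / 2 := by
    rw [hu, ← one_div]; exact one_div_le_one_div_of_le two_pos (le_add_of_le_of_nonneg he (by positivity))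
  have hw2 : w ≤ 1 / 2 := by
    rw [hw, ← one_div]; exact one_div_le_one_div_of_le two_pos (le_add_of_le_of_nonneg he (by positivity))
  have hau : A₀ / ε * u ≤ 1 := by
    rw [hu, mul_inv_le_iff₀ (by positivity)]; linarith
  have haw : A₁ / ε * w ≤ 1 := by
    rw [hw, mul_inv_le_iff₀ (by positivity)]; linarith
  have hbw : b * w ≤ 1 := by
    rw [hw, mul_inv_le_iff₀ (by positivity)]
    have : 0 ≤ A₁ / ε := by positivity
    linarith
  -- This is where `ε < D ^ 2` is essential: it lets `A₁ / ε` dominate quantities free of `ε`, and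
  -- so `w` cancels them too.
  have hm : M / (ρ * (γ * μ)) ≤ A₁ / ε := by
    have h1 : M / (ρ * (γ * μ)) * D ^ 2 ≤ A₁ := by
      rw [hA₁]; unfold argH₁
      rw [div_mul_eq_mul_div, mul_comm (γ * μ) ρ]
      gcongr
      have : 0 ≤ γ ^ 2 * L ^ 2 + γ * L ^ 2 / μ := by positivity
      nlinarith [mul_nonneg this (mul_nonneg hM0.le (sq_nonneg D))]
    rw [le_div_iff₀ hε]
    refine le_trans ?_ h1
    gcongr
  have hmw : M / (ρ * (γ * μ)) * w ≤ 1 := (mul_le_mul_of_nonneg_right hm hw0).trans haw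
  have hMw : M / Real.sqrt ρ * w ≤ 1 := by
    refine le_trans ?_ hmw
    gcongr
    nlinarith
  have hMw' : M * w ≤ 1 := by
    refine le_trans ?_ hMw
    gcongr
    exact le_div_self hM0.le hs hs1
  exact gossip_error_le_of_rates hM0 hγ hμ hγμ hL hD hB hρ hρ1 hε hεD hr hk₀ hk₁ hA₀ hA₁ hA₀0 hA₁0 hb
    hb0 hu0 hw0 hu2 hw2 h₀ h₁ hau haw hbw hmw hMw hMw' hS hlam

/-- Geometric decay of the initial distance. -/
theorem one_sub_pow_mul_le {x q ε : ℝ} (hx0 : 0 < x) (hx1 : x ≤ 1) (hq : 0 ≤ q) (hε : 0 < ε)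
    {k : ℕ} (hk : 60 * (1 / x) * logE (q / ε) ≤ k) : (1 - x / 4) ^ k * q ≤ ε / 2 := by
  have ha : 0 ≤ q / ε := by positivity
  have he := two_le_exp_one
  set w := (Real.exp 1 + q / ε)⁻¹ with hw
  have hw0 : 0 ≤ w := by positivity
  have hw2 : w ≤ 1 / 2 := by
    rw [hw, ← one_div]; exact one_div_le_one_div_of_le two_pos (le_add_of_le_of_nonneg he ha)
  have haw : q / ε * w ≤ 1 := by
    rw [hw, mul_inv_le_iff₀ (by positivity)]; linarith
  have hw14 : w ^ 14 ≤ (1 / 2) ^ 14 := by gcongr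
  have h1 : (1 - x / 4) ^ k ≤ w ^ 15 := by
    have h2 : 0 ≤ 1 - x / 4 := by linarith
    calc (1 - x / 4) ^ k ≤ Real.exp (-(x / 4)) ^ k := by
          gcongr
          linarith [Real.add_one_le_exp (-(x / 4))]
      _ = Real.exp (k * -(x / 4)) := (Real.exp_nat_mul _ _).symm
      _ ≤ Real.exp (-((15 : ℕ) * logE (q / ε))) := by
        gcongr
        have h3 := mul_le_mul_of_nonneg_left hk hx0.le
        have h4 : x * (60 * (1 / x) * logE (q / ε)) = 60 * logE (q / ε) := by field_simp
        push_cast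
        nlinarith
      _ = w ^ 15 := exp_neg_mul_logE ha 15
  calc (1 - x / 4) ^ k * q ≤ w ^ 15 * q := by gcongr
    _ = ε * (q / ε * w) * w ^ 14 := by field_simp
    _ ≤ ε * 1 * (1 / 2) ^ 14 := by gcongr
    _ ≤ ε / 2 := by linarith

/-- Each rounded count is absorbed into a multiple of a product of factors that are at least `1`.
The constants are `124 = 62 · 2` per gossip call, `1464 = 61 · 12 · 2` for the iterations, and
`363072 = 1464 · 2 · 124`. -/
theorem commRounds_le {ρ x c ε q a₀ a₁ b : ℝ} (hρ : 0 < ρ) (hρ1 : ρ ≤ 1) (hx0 : 0 < x)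
    (hx1 : x ≤ 1) (hxc : 1 / x ≤ 12 * c) (hε : 0 < ε) (hq : 0 ≤ q) (ha₀ : 0 ≤ a₀)
    (ha₁ : 0 ≤ a₁) (hb : 0 ≤ b) :
    (commRounds ⌈60 * (1 / Real.sqrt ρ) * logE (a₀ / ε)⌉₊
      ⌈60 * (1 / Real.sqrt ρ) * logE (a₁ / ε + b)⌉₊ ⌈60 * (1 / x) * logE (q / ε)⌉₊ : ℝ) ≤
      363072 * (logE q * (logE a₀ + logE (a₁ + b))) *
        ((1 / Real.sqrt ρ) * c * logE (1 / ε) ^ 2) := by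
  have hs : 1 ≤ 1 / Real.sqrt ρ := by
    rw [one_le_div (Real.sqrt_pos.2 hρ)]; exact Real.sqrt_le_one.2 hρ1
  have hx : 1 ≤ 1 / x := by rwa [one_le_div hx0]
  set s := 1 / Real.sqrt ρ with hsdef
  set y := 1 / x with hy
  have hl := one_le_logE (by positivity : 0 ≤ 1 / ε)
  have h0 := logE_div_le ha₀ le_rfl hε
  rw [add_zero, add_zero] at h0
  have h1 := logE_div_le ha₁ hb hε
  have h2 := logE_div_le hq le_rfl hε
  rw [add_zero, add_zero] at h2
  have g0 := one_le_logE (by positivity : 0 ≤ a₀ / ε)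
  have g1 := one_le_logE (by positivity : 0 ≤ a₁ / ε + b)
  have g2 := one_le_logE (by positivity : 0 ≤ q / ε)
  have k0 := one_le_logE ha₀
  have k1 := one_le_logE (by positivity : 0 ≤ a₁ + b)
  have k2 := one_le_logE hq
  set l := logE (1 / ε)
  have hceil : ∀ {t p : ℝ}, 1 ≤ t → 1 ≤ p → ((⌈60 * t * p⌉₊ : ℕ) : ℝ) + 1 ≤ 62 * (t * p) := by
    intro t p ht hp
    have := Nat.ceil_lt_add_one (by positivity : 0 ≤ 60 * t * p)
    nlinarith
  have c0 : ((⌈60 * s * logE (a₀ / ε)⌉₊ : ℕ) : ℝ) + 1 ≤ 124 * (s * (logE a₀ * l)) := by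
    refine (hceil hs g0).trans ?_
    calc _ ≤ 62 * (s * (2 * (logE a₀ * l))) := by gcongr
      _ = _ := by ring
  have c1 : ((⌈60 * s * logE (a₁ / ε + b)⌉₊ : ℕ) : ℝ) + 1 ≤ 124 * (s * (logE (a₁ + b) * l)) := by
    refine (hceil hs g1).trans ?_
    calc _ ≤ 62 * (s * (2 * (logE (a₁ + b) * l))) := by gcongr
      _ = _ := by ring
  have hc : 0 ≤ c := by linarith
  have hc' : 0 ≤ 12 * c := by linarith
  have c2 : ((⌈60 * y * logE (q / ε)⌉₊ : ℕ) : ℝ) ≤ 1464 * (c * (logE q * l)) := by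
    have h3 : ((⌈60 * y * logE (q / ε)⌉₊ : ℕ) : ℝ) ≤ 61 * (y * logE (q / ε)) := by
      have := Nat.ceil_lt_add_one (by positivity : 0 ≤ 60 * y * logE (q / ε))
      nlinarith
    refine h3.trans ?_
    calc _ ≤ 61 * (12 * c * (2 * (logE q * l))) := by gcongr
      _ = _ := by ring
  unfold commRounds
  push_cast
  calc _ = ((⌈60 * y * logE (q / ε)⌉₊ : ℕ) : ℝ) * (2 * (((⌈60 * s * logE (a₀ / ε)⌉₊ : ℕ) : ℝ) + 1) +
        2 * (((⌈60 * s * logE (a₁ / ε + b)⌉₊ : ℕ) : ℝ) + 1)) := by ring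
    _ ≤ (1464 * (c * (logE q * l))) * (2 * (124 * (s * (logE a₀ * l))) +
        2 * (124 * (s * (logE (a₁ + b) * l)))) := by gcongr
    _ = _ := by ring

end Tuning

/-! ### Convergence of a run -/

section Convergence

variable {d M : ℕ} {X Y : Set (E d)} {f : Fin M → V d → ℝ} {L μ r δ : ℝ}
  {G : SimpleGraph (Fin M)} {W : Matrix (Fin M) (Fin M) ℝ}

theorem IsSmoothSaddleProblem.run_mem (hP : IsSmoothSaddleProblem X Y f L μ r) {η γ e : ℝ}
    {H₀ H₁ : ℕ} {z₀ : V d} {node : ℕ → Fin M} {u : ℕ → V d} {z : ℕ → Fin M → V d}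
    (hz₀ : z₀ ∈ feasible X Y) (hrun : IsRun X Y f W η γ e H₀ H₁ z₀ node u z) (k : ℕ)
    (i : Fin M) : z k i ∈ feasible X Y := by
  cases k with
  | zero => rw [hrun.init]; exact hz₀
  | succ k => rw [hrun.update]; exact proj_mem hP.isCompact hP.nonempty _

/-- Linear convergence of the local points to a neighbourhood of the solution. -/
theorem IsSmoothSaddleProblem.norm_sq_run_sub_le (hP : IsSmoothSaddleProblem X Y f L μ r)
    (hRel : IsRelated X Y f δ) (hr : 0 < r) (hL : 0 ≤ L) (hμ : 0 < μ)
    (hW : IsGossipMatrix G W) (hG : G.Connected) (hM : 2 ≤ M) {zs : V d}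
    (hzs : IsSolution X Y (avgFun f) zs) {D B : ℝ} (hD : ∀ z ∈ feasible X Y, ‖z‖ ≤ D)
    (hD' : ∀ z ∈ feasible X Y, ∀ w ∈ feasible X Y, ‖z - w‖ ≤ D)
    (hB : ∀ m, ‖spOp (f m) zs‖ ≤ B) {γ e : ℝ} (hγ : 0 < γ) (hγμ : γ * μ ≤ 1 / 12)
    (hγδ : γ * δ ≤ 1 / 7) (he : e * (8 + 4 * (γ * μ)) ≤ γ * μ) {H₀ H₁ : ℕ} {S lam : ℝ}
    (hS : gossipRate (eigengap hW.isHermitian hM) H₁ * (M * (3 * D)) ≤ S) (hSr : S < r)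
    (hSD : S ≤ D)
    (hlam : gossipRate (eigengap hW.isHermitian hM) H₀ * (Real.sqrt M * (L * (2 * D) + B)) +
      L * (2 * S) ≤ lam)
    (hlamD : 7 * (γ ^ 2 + γ / μ) * lam ^ 2 ≤ D ^ 2) {z₀ : V d} (hz₀ : z₀ ∈ feasible X Y)
    {node : ℕ → Fin M} {u : ℕ → V d} {z : ℕ → Fin M → V d}
    (hrun : IsRun X Y f W (momentum (eigengap hW.isHermitian hM)) γ e H₀ H₁ z₀ node u z) (k : ℕ)
    (i : Fin M) :
    ‖z k i - zs‖ ^ 2 ≤ (1 - γ * μ / 4) ^ k * ‖z₀ - zs‖ ^ 2 +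
      4 / (γ * μ) * (14 * (γ ^ 2 + γ / μ) * lam ^ 2 + (1 + 4 / (γ * μ)) * S ^ 2) := by
  have hx0 : 0 < γ * μ := mul_pos hγ hμ
  have hD0 : 0 ≤ D := (norm_nonneg _).trans (hD zs hzs.1)
  have hS0 : 0 ≤ S := le_trans
    (mul_nonneg (gossipRate_nonneg _ _) (by positivity)) hS
  set c := 14 * (γ ^ 2 + γ / μ) * lam ^ 2 + (1 + 4 / (γ * μ)) * S ^ 2 with hc
  have hc0 : 0 ≤ c := by positivity
  -- The disagreement between nodes starts at zero and is carried along in the induction. The value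
  -- `4 / (γ μ) * c` is the fixed point of `a ↦ (1 - γ μ / 4) a + c`, so the bound reproduces
  -- itself.
  have key : ∀ k, (∀ i j, ‖z k i - z k j‖ ≤ 2 * S) ∧
      ∀ i, ‖z k i - zs‖ ^ 2 ≤ (1 - γ * μ / 4) ^ k * ‖z₀ - zs‖ ^ 2 + 4 / (γ * μ) * c := by
    intro k
    induction k with
    | zero =>
      refine ⟨fun i j => ?_, fun i => ?_⟩
      · rw [hrun.init, hrun.init, sub_self, norm_zero]; positivity
      · rw [hrun.init, pow_zero, one_mul]
        have : 0 ≤ 4 / (γ * μ) * c := by positivity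
        linarith
    | succ k ih =>
      obtain ⟨-, h1, h2⟩ := hP.iteration_le hRel hr hL hμ hW hG hM hzs hD hD' hB hγ hγμ hγδ he hS
        hSr hSD hlam hlamD (hP.run_mem hz₀ hrun k) ih.1 ih.2 (hrun.solve k) (hrun.update k)
      refine ⟨h1, fun i => (h2 i).trans_eq ?_⟩
      rw [← hc]
      clear_value c
      field_simp
      ring
  exact (key k).2 i

end Convergence

end MinMaxSimilarity

/-! ### The main theorem -/

open MinMaxSimilarity in
theorem theorem4 :
    -- absolute constants
    ∃ C > (0 : ℝ), ∃ C' > (0 : ℝ),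
    ∀ (d M : ℕ) (hM : 2 ≤ M)
      -- the network
      (G : SimpleGraph (Fin M)) (_ : G.Connected)
      (W : Matrix (Fin M) (Fin M) ℝ) (hW : IsGossipMatrix G W)
      -- the problem
      (X Y : Set (E d)) (f : Fin M → V d → ℝ) (L μ δ r : ℝ)
      (_ : 0 < L) (_ : 0 < μ) (_ : 0 < δ) (_ : 0 < r)
      (_ : IsSmoothSaddleProblem X Y f L μ r) (_ : IsRelated X Y f δ)
      (zstar : V d) (_ : IsSolution X Y (avgFun f) zstar)
      -- bounds on the feasible set and on the local operators at the solution
      (D B : ℝ)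
      (_ : ∀ z ∈ feasible X Y, ‖z‖ ≤ D) (_ : ∀ z ∈ feasible X Y, ∀ w ∈ feasible X Y, ‖z - w‖ ≤ D)
      (_ : ∀ m, ‖spOp (f m) zstar‖ ≤ B)
      -- starting point and target accuracy
      (z₀ : V d) (_ : z₀ ∈ feasible X Y) (ε : ℝ) (_ : 0 < ε),
      let ρ := eigengap hW.isHermitian hM
      let η := momentum ρ
      let γ := stepSize μ δ
      let e := innerAcc γ μ δ
      let T := ⌈C * (1 + γ * L) * Real.log (1 / e)⌉₊
      let H₀ := ⌈C * (1 / Real.sqrt ρ) * logE (argH₀ M γ μ L D B ρ / ε)⌉₊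
      let H₁ := ⌈C * (1 / Real.sqrt ρ) * logE (argH₁ M γ μ L D ρ / ε + D / (r * ρ))⌉₊
      let K := ⌈C * (1 / (γ * μ)) * logE (‖z₀ - zstar‖ ^ 2 / ε)⌉₊
      -- `T` Extragradient iterations solve every subproblem to the required accuracy
      (∀ m, ∀ z ∈ feasible X Y, ∀ v : V d, ∀ n ≥ T,
        IsApproxSolution X Y γ e (f m) z v
          (extragradient X Y γ (1 / (4 * (1 + γ * L))) (f m) z v n)) ∧
      -- accuracy `ε` after `K` iterations, for every realization of the active nodes
      (∀ (node : ℕ → Fin M) (u : ℕ → V d) (z : ℕ → Fin M → V d),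
        IsRun X Y f W η γ e H₀ H₁ z₀ node u z →
        ∀ k ≥ K, ‖avgPoint (z k) - zstar‖ ^ 2 ≤ ε) ∧
      -- the number of communication rounds
      (commRounds H₀ H₁ K : ℝ) ≤
        C' * (logE (‖z₀ - zstar‖ ^ 2) *
            (logE (argH₀ M γ μ L D B ρ) + logE (argH₁ M γ μ L D ρ + D / (r * ρ)))) *
          ((1 / Real.sqrt ρ) * (1 + δ / μ) * logE (1 / ε) ^ 2) := by
  refine ⟨60, by norm_num, 363072, by norm_num, ?_⟩
  intro d M hM G hG W hW X Y f L μ δ r hL hμ hδ hr hP hRel zstar hzs D B hD hD' hB z₀ hz₀ ε hε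
    ρ η γ e T H₀ H₁ K
  obtain ⟨hρ0, hρ1⟩ := hW.eigengap_mem hG hM
  have hγ : 0 < γ := stepSize_pos hμ hδ
  have hγμ : γ * μ ≤ 1 / 12 := stepSize_mul_le hμ
  have hγδ : γ * δ ≤ 1 / 7 := stepSize_mul_le' hδ
  have hx0 : 0 < γ * μ := mul_pos hγ hμ
  have he0 : 0 < e := innerAcc_pos hγ hμ
  have he : e * (8 + 4 * (γ * μ)) ≤ γ * μ := innerAcc_mul_le hγ hμ
  have hD0 : 0 ≤ D := (norm_nonneg _).trans (hD zstar hzs.1)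
  have hM0 : 0 < M := by omega
  have hB0 : 0 ≤ B := (norm_nonneg _).trans (hB ⟨0, hM0⟩)
  have hA₀ : 0 ≤ argH₀ M γ μ L D B ρ := by unfold argH₀; positivity
  have hA₁ : 0 ≤ argH₁ M γ μ L D ρ := by unfold argH₁; positivity
  have hb : 0 ≤ D / (r * ρ) := by positivity
  refine ⟨fun m z hz v n hn => ?_, fun node u z hrun k hk => ?_, ?_⟩
  · refine hP.isApproxSolution_extragradient hr hL.le hγ.le m v hz he0 ?_
    have h1 : (T : ℝ) ≤ n := by exact_mod_cast hn
    refine le_trans ?_ ((Nat.le_ceil _).trans h1)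
    have h2 : 0 ≤ Real.log (1 / e) := by
      refine Real.log_nonneg ((one_le_div he0).2 ?_)
      nlinarith
    gcongr
    norm_num
  · have hmem := hP.run_mem hz₀ hrun k
    -- For `ε ≥ D ^ 2` feasibility of the local points suffices, since the feasible set has diameter
    -- at most `D`.
    by_cases hεD : ε < D ^ 2
    · have hDpos : 0 < D := by
        rcases hD0.eq_or_lt with h | h
        · rw [← h] at hεD; linarith
        · exact h
      obtain ⟨hSr, hSD, hlamD, herr⟩ := gossip_error_le hM0 hγ hμ hγμ hL.le hDpos hB0 hρ0 hρ1 hε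
        hεD hr (gossipRate_nonneg ρ H₀) (gossipRate_nonneg ρ H₁)
        (gossipRate_ceil_le hρ0 hρ1 (by positivity)) (gossipRate_ceil_le hρ0 hρ1 (by positivity))
        rfl rfl
      have hdecay : (1 - γ * μ / 4) ^ k * ‖z₀ - zstar‖ ^ 2 ≤ ε / 2 :=
        one_sub_pow_mul_le hx0 (by linarith) (sq_nonneg _) hε
          ((Nat.le_ceil _).trans (by exact_mod_cast hk))
      -- Every local point is within `√ε` of the solution, hence so is their average.
      have hle : ∀ i, ‖z k i - zstar‖ ≤ Real.sqrt ε := by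
        intro i
        refine Real.le_sqrt_of_sq_le ?_
        have h := hP.norm_sq_run_sub_le hRel hr hL.le hμ hW hG hM hzs hD hD' hB hγ hγμ hγδ he
          le_rfl hSr hSD le_rfl hlamD hz₀ hrun k i
        linarith
      have h := pow_le_pow_left₀ (norm_nonneg _) (norm_avgPoint_sub_le hM0 hle) 2
      rwa [Real.sq_sqrt hε.le] at h
    · have h := norm_avgPoint_sub_le hM0 (fun i => hD' _ (hmem i) _ hzs.1)
      exact (pow_le_pow_left₀ (norm_nonneg _) h 2).trans (not_lt.1 hεD)
  · exact commRounds_le hρ0 hρ1 hx0 (by linarith) (one_div_stepSize_mul_le hμ hδ) hε (sq_nonneg _)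
      hA₀ hA₁ hb
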